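/- Let $G$ be a finite group and $n\ge 0$. An $(n,G)$-simplex is a chain $X=(X_0\xrightarrow{f_1}X_1\to\cdots\xrightarrow{f_n}X_n)$ of finite $G$-sets and $G$-maps; an isomorphism of simplices is a family of $G$-isomorphisms $X_i\to Y_i$ commuting with the structure maps. If $X_i=A_i\sqcup B_i$ is a decomposition into $G$-stable subsets (possibly empty), let $A$ be the simplex $A_0\to\cdots\to A_i\to X_{i+1}\to\cdots\to X_n$ with $A_{j-1}=f_j^{-1}(A_j)$ for $1\le j\le i$, and define $B$ likewise. Let $B_n(G)$ be the free abelian group on the isomorphism classes of $(n,G)$-simplices modulo the subgroup generated by all elements $[X]-[A]-[B]$ of this kind, and let $\pi(X)\in B_n(G)$ be the class of $X$. The biset category has the finite groups as objects; $\mathrm{Hom}(G,H)=B(H,G)$ is the Grothendieck group of finite $(H,G)$-bisets with respect to disjoint union, composition is the bilinear extension of $(V,U)\mapsto V\times_H U$, and $\mathrm{Iso}(f)\in B(H,G)$ is the class of the biset $H$ attached to a group isomorphism $f:G\to H$. A biset functor is a $\mathbb Z$-linear functor from this category to $\mathbb Z$-modules. A Green biset functor is a biset functor $A$ with bilinear products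 $A(G)\times A(H)\to A(G\times H)$, $(a,b)\mapsto a\times b$, and an element $\epsilon_A\in A(1)$ such that (associativity) $(a\times b)\times c=A(\mathrm{Iso})(a\times(b\times c))$ for the canonical isomorphism $G\times(H\times K)\to(G\times H)\times K$; (identity) $A(\mathrm{Iso})(\epsilon_A\times a)=a=A(\mathrm{Iso})(a\times\epsilon_A)$ for the canonical isomorphisms $1\times G\to G$ and $G\times 1\to G$; (functoriality) $A(\varphi\times\psi)(a\times b)=A(\varphi)(a)\times A(\psi)(b)$ for all morphisms $\varphi,\psi$ of the biset category. A morphism of Green biset functors is a natural transformation compatible with the products and with the elements $\epsilon$. **Proposition.** For every $n\ge 0$ the correspondence $G\mapsto B_n(G)$ carries a structure of Green biset functor such that $B_n([U])(\pi(X))=\pi\big(U\times_G X_0\to U\times_G X_1\to\cdots\to U\times_G X_n\big)$ for every finite $(H,G)$-biset $U$ and every $(n,G)$-simplex $X$; $\pi(X)\times\pi(Y)=\pi\big(X_0\times Y_0\to\cdots\to X_n\times Y_n\big)$ for every $(n,G)$-simplex $X$ and every $(n,H)$-simplex $Y$, where $X_i\times Y_i$ is a $G\times H$-set componentwise; and $\epsilon_{B_n}\in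 B_n(1)$ is the class of the chain of one-point sets. Moreover, for $n\ge 1$, the face maps $d_j$, $1\le j\le n$, of the nerve of the category of finite $G$-sets (leaving out $X_j$, and composing $f_{j+1}\circ f_j$ if $j<n$) and the degeneracy maps $s_i$, $0\le i\le n-1$ (inserting $\mathrm{id}_{X_i}$) induce morphisms of Green biset functors $d_j:B_n\to B_{n-1}$ and $s_i:B_{n-1}\to B_n$, determined by $d_j(\pi(X))=\pi(d_jX)$ and $s_i(\pi(X))=\pi(s_iX)$. They satisfy the following identities whenever all face maps involved have positive index: $d_j\circ d_i=d_i\circ d_{j+1}$ for $i\le j$; $s_i\circ s_j=s_{j+1}\circ s_i$ for $i\le j$; and $d_i\circ s_j=s_{j-1}\circ d_i$ if $i<j$, $d_i\circ s_j=\mathrm{id}$ if $i=j$ or $i=j+1$, $d_i\circ s_j=s_j\circ d_{i-1}$ if $i>j+1$. -/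

import Mathlib

open CategoryTheory MulOpposite
open scoped Simplicial

universe u v

namespace SimplicialBurnside

/-! ## Grothendieck groups -/

section Grothendieck

variable {α β : Type*}

/-- The elements `[x] - [a] - [b]` of the free abelian group on the classes of `α` modulo the
equivalence relation `r`, for the triples `(x, a, b)` in `T`. -/
def grothendieckRelators (r : Setoid α) (T : Set (α × α × α)) :
    Set (FreeAbelianGroup (Quotient r)) :=
  { z | ∃ x a b, (x, a, b) ∈ T ∧ z = FreeAbelianGroup.of (Quotient.mk r x)
      - FreeAbelianGroup.of (Quotient.mk r a) - FreeAbelianGroup.of (Quotient.mk r b) }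

/-- The free abelian group on the classes of `α` modulo the equivalence relation `r`, divided by
the subgroup generated by the elements `[x] - [a] - [b]` for the triples `(x, a, b)` in `T`. -/
def GrothendieckGroup (r : Setoid α) (T : Set (α × α × α)) :=
  FreeAbelianGroup (Quotient r) ⧸ AddSubgroup.closure (grothendieckRelators r T)

namespace GrothendieckGroup

variable {r : Setoid α} {T : Set (α × α × α)} {r' : Setoid β} {T' : Set (β × β × β)}

instance : AddCommGroup (GrothendieckGroup r T) :=
  inferInstanceAs (AddCommGroup (FreeAbelianGroup (Quotient r) ⧸
    AddSubgroup.closure (grothendieckRelators r T)))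

/-- The class of `x` in the Grothendieck group. -/
def mk (r : Setoid α) (T : Set (α × α × α)) (x : α) : GrothendieckGroup r T :=
  (QuotientAddGroup.mk (FreeAbelianGroup.of (Quotient.mk r x)) :
    FreeAbelianGroup (Quotient r) ⧸ AddSubgroup.closure (grothendieckRelators r T))

theorem mk_eq_of_rel {x y : α} (h : r x y) : mk r T x = mk r T y := by
  unfold mk; rw [Quotient.sound h]

theorem mk_eq_add {x a b : α} (h : (x, a, b) ∈ T) : mk r T x = mk r T a + mk r T b := by
  have h1 := (QuotientAddGroup.eq_zero_iff _).2 (AddSubgroup.subset_closure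
    (k := grothendieckRelators r T) ⟨x, a, b, h, rfl⟩)
  have h2 : mk r T x - mk r T a - mk r T b = 0 := h1
  rw [sub_sub, sub_eq_zero] at h2
  exact h2

/-- The universal property of the Grothendieck group. -/
def lift {A : Type*} [AddCommGroup A] (f : α → A) (hr : ∀ x y, r x y → f x = f y)
    (hT : ∀ t ∈ T, f t.1 = f t.2.1 + f t.2.2) : GrothendieckGroup r T →+ A :=
  QuotientAddGroup.lift _ (FreeAbelianGroup.lift (Quotient.lift f hr)) (by
    rw [AddSubgroup.closure_le]
    rintro _ ⟨x, a, b, ht, rfl⟩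
    have := hT _ ht
    simp_all)

theorem lift_mk {A : Type*} [AddCommGroup A] (f : α → A) (hr : ∀ x y, r x y → f x = f y)
    (hT : ∀ t ∈ T, f t.1 = f t.2.1 + f t.2.2) (x : α) : lift f hr hT (mk r T x) = f x := by
  exact FreeAbelianGroup.lift_apply_of _ _

theorem hom_ext {A : Type*} [AddCommGroup A] {f g : GrothendieckGroup r T →+ A}
    (h : ∀ x, f (mk r T x) = g (mk r T x)) : f = g := by
  refine QuotientAddGroup.addMonoidHom_ext _ (FreeAbelianGroup.lift_ext _ _ fun q => ?_)
  induction q using Quotient.inductionOn with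
  | h x => exact h x

/-- Bilinear maps out of two Grothendieck groups. -/
def lift₂ {A : Type*} [AddCommGroup A] (f : α → β → A)
    (hr : ∀ x x' y, r x x' → f x y = f x' y) (hr' : ∀ x y y', r' y y' → f x y = f x y')
    (hT : ∀ t ∈ T, ∀ y, f t.1 y = f t.2.1 y + f t.2.2 y)
    (hT' : ∀ x, ∀ t ∈ T', f x t.1 = f x t.2.1 + f x t.2.2) :
    GrothendieckGroup r T →+ GrothendieckGroup r' T' →+ A :=
  lift (fun x => lift (f x) (hr' x) (hT' x))
    (fun x x' h => hom_ext fun y => by rw [lift_mk, lift_mk, hr x x' y h])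
    (fun t ht => hom_ext fun y => by
      rw [AddMonoidHom.add_apply, lift_mk, lift_mk, lift_mk, hT t ht y])

theorem lift₂_mk {A : Type*} [AddCommGroup A] (f : α → β → A)
    (hr : ∀ x x' y, r x x' → f x y = f x' y) (hr' : ∀ x y y', r' y y' → f x y = f x y')
    (hT : ∀ t ∈ T, ∀ y, f t.1 y = f t.2.1 y + f t.2.2 y)
    (hT' : ∀ x, ∀ t ∈ T', f x t.1 = f x t.2.1 + f x t.2.2) (x : α) (y : β) :
    lift₂ f hr hr' hT hT' (mk r T x) (mk r' T' y) = f x y := by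
  unfold lift₂
  rw [lift_mk, lift_mk]

end GrothendieckGroup

end Grothendieck

/-! ## The product `V ×_H U` over a group -/

section Tensor

/-- The orbit relation on `V × U` of the right action `(v, u) · h = (v · h, h⁻¹ · u)` of `H`. -/
def tensorSetoid (H V U : Type*) [Group H] [MulAction Hᵐᵒᵖ V] [MulAction H U] :
    Setoid (V × U) where
  r p q := ∃ h : H, q = (op h • p.1, h⁻¹ • p.2)
  iseqv :=
    { refl := fun p => ⟨1, by simp⟩
      symm := by
        rintro p _ ⟨h, rfl⟩
        refine ⟨h⁻¹, ?_⟩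
        simp [smul_smul]
      trans := by
        rintro p _ _ ⟨h, rfl⟩ ⟨k, rfl⟩
        refine ⟨h * k, ?_⟩
        simp [smul_smul, ← op_mul] }

/-- `V ×_H U`, for a right `H`-set `V` and a left `H`-set `U`. -/
def Tensor (H V U : Type*) [Group H] [MulAction Hᵐᵒᵖ V] [MulAction H U] : Type _ :=
  Quotient (tensorSetoid H V U)

namespace Tensor

variable {H V U : Type*} [Group H] [MulAction Hᵐᵒᵖ V] [MulAction H U]

/-- The class of `(v, u)`. -/
def mk (v : V) (u : U) : Tensor H V U := Quotient.mk (tensorSetoid H V U) (v, u)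

theorem ind {P : Tensor H V U → Prop} (h : ∀ v u, P (mk v u)) (t : Tensor H V U) : P t :=
  Quotient.ind (fun p => h p.1 p.2) t

theorem mk_op_smul (h : H) (v : V) (u : U) :
    (mk (op h • v) u : Tensor H V U) = mk v (h • u) := by
  refine (Quotient.sound ⟨h, ?_⟩ : (mk v (h • u) : Tensor H V U) = _).symm
  simp

/-- Functions out of `V ×_H U`. -/
def desc {W : Type*} (f : V → U → W) (hf : ∀ (h : H) v u, f (op h • v) u = f v (h • u)) :
    Tensor H V U → W :=
  Quotient.lift (fun p => f p.1 p.2) (by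
    rintro p _ ⟨h, rfl⟩
    simp [hf])

@[simp] theorem desc_mk {W : Type*} (f : V → U → W)
    (hf : ∀ (h : H) v u, f (op h • v) u = f v (h • u)) (v : V) (u : U) :
    desc f hf (mk v u) = f v u := rfl

instance [Finite V] [Finite U] : Finite (Tensor H V U) :=
  inferInstanceAs (Finite (Quotient _))

section Left

variable {K : Type*} [Group K] [MulAction K V] [SMulCommClass K Hᵐᵒᵖ V]

/-- The left action on `V ×_H U` coming from a left action on `V`. -/
instance leftAction : MulAction K (Tensor H V U) where
  smul k := desc (fun v u => mk (k • v) u) (fun h v u => by rw [smul_comm, mk_op_smul])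
  one_smul := ind fun v u => congrArg (fun w => (mk w u : Tensor H V U)) (one_smul K v)
  mul_smul k l := ind fun v u =>
    congrArg (fun w => (mk w u : Tensor H V U)) (mul_smul k l v)

@[simp] theorem left_smul_mk (k : K) (v : V) (u : U) :
    k • (mk v u : Tensor H V U) = mk (k • v) u := rfl

end Left

section Right

variable {G : Type*} [Group G] [MulAction Gᵐᵒᵖ U] [SMulCommClass H Gᵐᵒᵖ U]

/-- The right action on `V ×_H U` coming from a right action on `U`. -/
instance rightAction : MulAction Gᵐᵒᵖ (Tensor H V U) where
  smul g := desc (fun v u => mk v (g • u)) (fun h v u => by rw [mk_op_smul, smul_comm])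
  one_smul := ind fun v u => congrArg (fun w => (mk v w : Tensor H V U)) (one_smul _ u)
  mul_smul k l := ind fun v u =>
    congrArg (fun w => (mk v w : Tensor H V U)) (mul_smul k l u)

@[simp] theorem right_smul_mk (g : Gᵐᵒᵖ) (v : V) (u : U) :
    g • (mk v u : Tensor H V U) = mk v (g • u) := rfl

end Right

instance {K G : Type*} [Group K] [MulAction K V] [SMulCommClass K Hᵐᵒᵖ V]
    [Group G] [MulAction Gᵐᵒᵖ U] [SMulCommClass H Gᵐᵒᵖ U] :
    SMulCommClass K Gᵐᵒᵖ (Tensor H V U) where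
  smul_comm _ _ := ind fun _ _ => rfl

/-- Functoriality of `V ×_H U` for equivariant bijections. -/
def congr {V' U' : Type*} [MulAction Hᵐᵒᵖ V'] [MulAction H U'] (e : V ≃ V') (f : U ≃ U')
    (he : ∀ (h : H) v, e (op h • v) = op h • e v) (hf : ∀ (h : H) u, f (h • u) = h • f u) :
    Tensor H V U ≃ Tensor H V' U' where
  toFun := desc (fun v u => mk (e v) (f u)) (fun h v u => by rw [he, hf, mk_op_smul])
  invFun := desc (fun v u => mk (e.symm v) (f.symm u)) (fun h v u => by
    have h1 : e.symm (op h • v) = op h • e.symm v := by simp [Equiv.symm_apply_eq, he]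
    have h2 : f.symm (h • u) = h • f.symm u := by simp [Equiv.symm_apply_eq, hf]
    rw [h1, h2, mk_op_smul])
  left_inv := ind fun v u => by simp
  right_inv := ind fun v u => by simp

/-- `(V₁ ⊔ V₂) ×_H U = (V₁ ×_H U) ⊔ (V₂ ×_H U)`. -/
def sumLeft (H V₁ V₂ U : Type*) [Group H] [MulAction Hᵐᵒᵖ V₁] [MulAction Hᵐᵒᵖ V₂]
    [MulAction H U] : Tensor H (V₁ ⊕ V₂) U ≃ Tensor H V₁ U ⊕ Tensor H V₂ U where
  toFun := desc (fun v u => Sum.map (fun v => mk v u) (fun v => mk v u) v) (fun h v u => by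
    cases v
    · exact congrArg Sum.inl (mk_op_smul h _ u)
    · exact congrArg Sum.inr (mk_op_smul h _ u))
  invFun := Sum.elim (desc (fun v u => mk (Sum.inl v) u) (fun h v u => mk_op_smul h (Sum.inl v) u))
    (desc (fun v u => mk (Sum.inr v) u) (fun h v u => mk_op_smul h (Sum.inr v) u))
  left_inv := ind fun v u => by cases v <;> rfl
  right_inv t := by
    rcases t with t | t <;> induction t using ind <;> rfl

/-- `V ×_H (U₁ ⊔ U₂) = (V ×_H U₁) ⊔ (V ×_H U₂)`. -/
def sumRight (H V U₁ U₂ : Type*) [Group H] [MulAction Hᵐᵒᵖ V] [MulAction H U₁]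
    [MulAction H U₂] : Tensor H V (U₁ ⊕ U₂) ≃ Tensor H V U₁ ⊕ Tensor H V U₂ where
  toFun := desc (fun v u => Sum.map (fun u => mk v u) (fun u => mk v u) u) (fun h v u => by
    cases u
    · exact congrArg Sum.inl (mk_op_smul h v _)
    · exact congrArg Sum.inr (mk_op_smul h v _))
  invFun := Sum.elim (desc (fun v u => mk v (Sum.inl u)) (fun h v u => mk_op_smul h v (Sum.inl u)))
    (desc (fun v u => mk v (Sum.inr u)) (fun h v u => mk_op_smul h v (Sum.inr u)))
  left_inv := ind fun v u => by cases u <;> rfl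
  right_inv t := by
    rcases t with t | t <;> induction t using ind <;> rfl

/-- `(W ×_K V) ×_H U = W ×_K (V ×_H U)`. -/
def assoc (K H W V U : Type*) [Group K] [Group H] [MulAction Kᵐᵒᵖ W] [MulAction K V]
    [MulAction Hᵐᵒᵖ V] [MulAction H U] [SMulCommClass K Hᵐᵒᵖ V] :
    Tensor H (Tensor K W V) U ≃ Tensor K W (Tensor H V U) where
  toFun := desc (fun t u => desc (fun w v => mk w (mk v u))
      (fun k w v => mk_op_smul k w (mk v u)) t)
    (fun h t u => by
      induction t using ind with
      | h w v => exact congrArg (mk w) (mk_op_smul h v u))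
  invFun := desc (fun w t => desc (fun v u => mk (mk w v) u)
      (fun h v u => mk_op_smul h (mk w v) u) t)
    (fun k w t => by
      induction t using ind with
      | h v u => exact congrArg (fun z => mk z u) (mk_op_smul k w v))
  left_inv := ind fun t u => by induction t using ind; rfl
  right_inv := ind fun w t => by induction t using ind; rfl

end Tensor

end Tensor

/-! ## Bisets and their Burnside groups -/

/-- A finite `(H, G)`-biset: a finite set with a left action of `H` and a right action of `G`
that commute. -/
structure Biset (H G : Type u) [Group H] [Group G] : Type (u + 1) where
  carrier : Type u
  [finite : Finite carrier]
  [left : MulAction H carrier]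
  [right : MulAction Gᵐᵒᵖ carrier]
  [comm : SMulCommClass H Gᵐᵒᵖ carrier]

attribute [instance] Biset.finite Biset.left Biset.right Biset.comm

namespace Biset

variable {K H G L : Type u} [Group K] [Group H] [Group G] [Group L]

/-- Isomorphisms of bisets. -/
structure Iso (U V : Biset H G) extends U.carrier ≃ V.carrier where
  map_left : ∀ (h : H) x, toFun (h • x) = h • toFun x
  map_right : ∀ (g : G) x, toFun (op g • x) = op g • toFun x

/-- Being isomorphic. -/
def isoSetoid (H G : Type u) [Group H] [Group G] : Setoid (Biset H G) where
  r U V := Nonempty (Iso U V)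
  iseqv :=
    { refl := fun U => ⟨⟨Equiv.refl _, fun _ _ => rfl, fun _ _ => rfl⟩⟩
      symm := by
        rintro U V ⟨e⟩
        refine ⟨⟨e.toEquiv.symm, fun h x => ?_, fun g x => ?_⟩⟩
        · apply e.toEquiv.injective
          have := e.map_left h (e.toEquiv.symm x)
          simp_all
        · apply e.toEquiv.injective
          have := e.map_right g (e.toEquiv.symm x)
          simp_all
      trans := by
        rintro U V W ⟨e⟩ ⟨f⟩
        refine ⟨⟨e.toEquiv.trans f.toEquiv, fun h x => ?_, fun g x => ?_⟩⟩
        · exact (congrArg f.toFun (e.map_left h x)).trans (f.map_left h _)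
        · exact (congrArg f.toFun (e.map_right g x)).trans (f.map_right g _) }

/-- The disjoint union of two bisets. -/
def sum (U V : Biset H G) : Biset H G where
  carrier := U.carrier ⊕ V.carrier

/-- The composition `V ×_H U` of a `(K, H)`-biset and an `(H, G)`-biset, a `(K, G)`-biset. -/
def comp (V : Biset K H) (U : Biset H G) : Biset K G where
  carrier := Tensor H V.carrier U.carrier

/-- The `(H, G)`-biset `H` with `h · x · g = h x f(g)`, for a group isomorphism `f : G → H`. -/
def ofEquiv [Finite H] (f : G ≃* H) : Biset H G :=
  letI : MulAction Gᵐᵒᵖ H :=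
    { smul := fun g x => x * f (unop g)
      one_smul := fun x => by
        change x * f 1 = x
        simp
      mul_smul := fun a b x => by
        change x * f (unop b * unop a) = x * f (unop b) * f (unop a)
        simp [mul_assoc] }
  { carrier := H
    comm := ⟨fun h g x => by
      change h * (x * f (unop g)) = h * x * f (unop g)
      rw [mul_assoc]⟩ }

/-- The product of an `(H, G)`-biset and a `(K, L)`-biset, an `(H × K, G × L)`-biset with the
componentwise actions. -/
def prod (U : Biset H G) (V : Biset K L) : Biset (H × K) (G × L) :=
  letI : MulAction (H × K) (U.carrier × V.carrier) :=
    { smul := fun h x => (h.1 • x.1, h.2 • x.2)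
      one_smul := fun x => Prod.ext (one_smul H x.1) (one_smul K x.2)
      mul_smul := fun a b x => Prod.ext (mul_smul a.1 b.1 x.1) (mul_smul a.2 b.2 x.2) }
  letI : MulAction (G × L)ᵐᵒᵖ (U.carrier × V.carrier) :=
    { smul := fun g x => (op (unop g).1 • x.1, op (unop g).2 • x.2)
      one_smul := fun x => Prod.ext (one_smul Gᵐᵒᵖ x.1) (one_smul Lᵐᵒᵖ x.2)
      mul_smul := fun a b x => Prod.ext
        (mul_smul (op (unop a).1) (op (unop b).1) x.1)
        (mul_smul (op (unop a).2) (op (unop b).2) x.2) }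
  { carrier := U.carrier × V.carrier
    comm := ⟨fun h g x => Prod.ext (smul_comm h.1 (op (unop g).1) x.1)
      (smul_comm h.2 (op (unop g).2) x.2)⟩ }

/-! ### Compatibility of these operations with isomorphisms and disjoint unions -/

/-- Functoriality of the composition. -/
def compIso {V V' : Biset K H} {U U' : Biset H G} (e : Iso V V') (f : Iso U U') :
    Iso (V.comp U) (V'.comp U') where
  toEquiv := Tensor.congr e.toEquiv f.toEquiv e.map_right f.map_left
  map_left k := Tensor.ind fun v u =>
    congrArg (fun w => Tensor.mk w (f.toEquiv u)) (e.map_left k v)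
  map_right g := Tensor.ind fun v u =>
    congrArg (fun w => Tensor.mk (e.toEquiv v) w) (f.map_right g u)

/-- `(V₁ ⊔ V₂) ×_H U ≅ (V₁ ×_H U) ⊔ (V₂ ×_H U)`. -/
def sumCompIso (V₁ V₂ : Biset K H) (U : Biset H G) :
    Iso ((V₁.sum V₂).comp U) ((V₁.comp U).sum (V₂.comp U)) where
  toEquiv := Tensor.sumLeft H V₁.carrier V₂.carrier U.carrier
  map_left k := Tensor.ind fun v u => by rcases v with v | v <;> rfl
  map_right g := Tensor.ind fun v u => by rcases v with v | v <;> rfl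

/-- `V ×_H (U₁ ⊔ U₂) ≅ (V ×_H U₁) ⊔ (V ×_H U₂)`. -/
def compSumIso (V : Biset K H) (U₁ U₂ : Biset H G) :
    Iso (V.comp (U₁.sum U₂)) ((V.comp U₁).sum (V.comp U₂)) where
  toEquiv := Tensor.sumRight H V.carrier U₁.carrier U₂.carrier
  map_left k := Tensor.ind fun v u => by rcases u with u | u <;> rfl
  map_right g := Tensor.ind fun v u => by rcases u with u | u <;> rfl

/-- Associativity of the composition. -/
def assocIso (W : Biset L K) (V : Biset K H) (U : Biset H G) :
    Iso ((W.comp V).comp U) (W.comp (V.comp U)) where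
  toEquiv := Tensor.assoc K H W.carrier V.carrier U.carrier
  map_left l := Tensor.ind fun t u => by
    change Tensor K W.carrier V.carrier at t
    induction t using Tensor.ind; rfl
  map_right g := Tensor.ind fun t u => by
    change Tensor K W.carrier V.carrier at t
    induction t using Tensor.ind; rfl

/-- The identity biset is a left unit. -/
def idCompIso [Finite H] (U : Biset H G) : Iso ((ofEquiv (MulEquiv.refl H)).comp U) U where
  toFun := Tensor.desc (fun (h : H) u => h • u) (fun h (x : H) u => mul_smul x h u)
  invFun u := Tensor.mk (1 : H) u
  left_inv := Tensor.ind fun h u => by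
    change H at h
    refine (Tensor.mk_op_smul h (V := (ofEquiv (MulEquiv.refl H)).carrier)
      (1 : H) u).symm.trans ?_
    exact congrArg (fun x => Tensor.mk (V := (ofEquiv (MulEquiv.refl H)).carrier) x u)
      (one_mul h)
  right_inv u := one_smul H u
  map_left k := Tensor.ind fun (h : H) u => mul_smul k h u
  map_right g := Tensor.ind fun (h : H) u => smul_comm h (op g) u

/-- The identity biset is a right unit. -/
def compIdIso [Finite G] (U : Biset H G) : Iso (U.comp (ofEquiv (MulEquiv.refl G))) U where
  toFun := Tensor.desc (fun u (g : G) => op g • u) (fun h u (x : G) => by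
    change op x • op h • u = op (h * x) • u
    rw [op_mul, mul_smul])
  invFun u := Tensor.mk u (1 : G)
  left_inv := Tensor.ind fun u g => by
    change G at g
    refine (Tensor.mk_op_smul g u (U := (ofEquiv (MulEquiv.refl G)).carrier)
      (1 : G)).trans ?_
    exact congrArg (fun x => Tensor.mk (U := (ofEquiv (MulEquiv.refl G)).carrier) u x)
      (mul_one g)
  right_inv u := one_smul _ u
  map_left k := Tensor.ind fun u (g : G) => (smul_comm k (op g) u).symm
  map_right g := Tensor.ind fun u (x : G) => mul_smul (op g) (op x) u

/-- Functoriality of the product. -/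
def prodIso {U U' : Biset H G} {V V' : Biset K L} (e : Iso U U') (f : Iso V V') :
    Iso (U.prod V) (U'.prod V') where
  toEquiv := e.toEquiv.prodCongr f.toEquiv
  map_left h x := Prod.ext (e.map_left h.1 x.1) (f.map_left h.2 x.2)
  map_right g x := Prod.ext (e.map_right g.1 x.1) (f.map_right g.2 x.2)

/-- `(U₁ ⊔ U₂) × V ≅ (U₁ × V) ⊔ (U₂ × V)`. -/
def sumProdIso (U₁ U₂ : Biset H G) (V : Biset K L) :
    Iso ((U₁.sum U₂).prod V) ((U₁.prod V).sum (U₂.prod V)) where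
  toEquiv := Equiv.sumProdDistrib _ _ _
  map_left := by rintro h ⟨x | x, y⟩ <;> rfl
  map_right := by rintro h ⟨x | x, y⟩ <;> rfl

/-- `U × (V₁ ⊔ V₂) ≅ (U × V₁) ⊔ (U × V₂)`. -/
def prodSumIso (U : Biset H G) (V₁ V₂ : Biset K L) :
    Iso (U.prod (V₁.sum V₂)) ((U.prod V₁).sum (U.prod V₂)) where
  toEquiv := Equiv.prodSumDistrib _ _ _
  map_left := by rintro h ⟨y, x | x⟩ <;> rfl
  map_right := by rintro h ⟨y, x | x⟩ <;> rfl

end Biset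

/-- The triples `(U ⊔ V, U, V)` of bisets. -/
def bisetRelations (H G : Type u) [Group H] [Group G] :
    Set (Biset H G × Biset H G × Biset H G) :=
  {t | ∃ U V : Biset H G, t = (U.sum V, U, V)}

/-- The biset Burnside group `B(H, G)`: the Grothendieck group of the finite `(H, G)`-bisets with
respect to disjoint unions. -/
abbrev BisetBurnside (H G : Type u) [Group H] [Group G] : Type (u + 1) :=
  GrothendieckGroup (Biset.isoSetoid H G) (bisetRelations H G)

namespace BisetBurnside

variable {K H G L : Type u} [Group K] [Group H] [Group G] [Group L]

/-- The class `[U]` of a biset in the biset Burnside group. -/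
def mk (U : Biset H G) : BisetBurnside H G := GrothendieckGroup.mk _ _ U

theorem mk_eq {U V : Biset H G} (e : Biset.Iso U V) : mk U = mk V :=
  GrothendieckGroup.mk_eq_of_rel ⟨e⟩

theorem mk_sum (U V : Biset H G) : mk (U.sum V) = mk U + mk V :=
  GrothendieckGroup.mk_eq_add ⟨U, V, rfl⟩

theorem hom_ext {A : Type*} [AddCommGroup A] {f g : BisetBurnside H G →+ A}
    (h : ∀ U, f (mk U) = g (mk U)) : f = g := GrothendieckGroup.hom_ext h

theorem isoRefl (U : Biset H G) : Nonempty (Biset.Iso U U) := (Biset.isoSetoid H G).refl U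

/-- The bilinear extension of `(V, U) ↦ V ×_H U`. -/
def comp (K H G : Type u) [Group K] [Group H] [Group G] :
    BisetBurnside K H →+ BisetBurnside H G →+ BisetBurnside K G :=
  GrothendieckGroup.lift₂ (fun V U => mk (V.comp U))
    (fun _ _ U ⟨e⟩ => mk_eq (Biset.compIso e (isoRefl U).some))
    (fun V _ _ ⟨e⟩ => mk_eq (Biset.compIso (isoRefl V).some e))
    (by
      rintro _ ⟨V₁, V₂, rfl⟩ U
      exact (mk_eq (Biset.sumCompIso V₁ V₂ U)).trans (mk_sum _ _))
    (by
      rintro V _ ⟨U₁, U₂, rfl⟩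
      exact (mk_eq (Biset.compSumIso V U₁ U₂)).trans (mk_sum _ _))

@[simp] theorem comp_mk (V : Biset K H) (U : Biset H G) :
    comp K H G (mk V) (mk U) = mk (V.comp U) := GrothendieckGroup.lift₂_mk _ _ _ _ _ _ _

/-- The bilinear extension of `(U, V) ↦ U × V`. -/
def prod (H G K L : Type u) [Group H] [Group G] [Group K] [Group L] :
    BisetBurnside H G →+ BisetBurnside K L →+ BisetBurnside (H × K) (G × L) :=
  GrothendieckGroup.lift₂ (fun U V => mk (U.prod V))
    (fun _ _ V ⟨e⟩ => mk_eq (Biset.prodIso e (isoRefl V).some))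
    (fun U _ _ ⟨e⟩ => mk_eq (Biset.prodIso (isoRefl U).some e))
    (by
      rintro _ ⟨U₁, U₂, rfl⟩ V
      exact (mk_eq (Biset.sumProdIso U₁ U₂ V)).trans (mk_sum _ _))
    (by
      rintro U _ ⟨V₁, V₂, rfl⟩
      exact (mk_eq (Biset.prodSumIso U V₁ V₂)).trans (mk_sum _ _))

@[simp] theorem prod_mk (U : Biset H G) (V : Biset K L) :
    prod H G K L (mk U) (mk V) = mk (U.prod V) := GrothendieckGroup.lift₂_mk _ _ _ _ _ _ _

theorem id_comp [Finite H] (x : BisetBurnside H G) :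
    comp H H G (mk (Biset.ofEquiv (MulEquiv.refl H))) x = x :=
  DFunLike.congr_fun (hom_ext (f := comp H H G (mk (Biset.ofEquiv (MulEquiv.refl H))))
    (g := AddMonoidHom.id _) fun U => by
      rw [comp_mk]; exact mk_eq (Biset.idCompIso U)) x

theorem comp_id [Finite G] (x : BisetBurnside H G) :
    comp H G G x (mk (Biset.ofEquiv (MulEquiv.refl G))) = x :=
  DFunLike.congr_fun (hom_ext
    (f := (comp H G G).flip (mk (Biset.ofEquiv (MulEquiv.refl G))))
    (g := AddMonoidHom.id _) fun U => by
      rw [AddMonoidHom.flip_apply, comp_mk]; exact mk_eq (Biset.compIdIso U)) x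

theorem comp_assoc (z : BisetBurnside L K) (y : BisetBurnside K H) (x : BisetBurnside H G) :
    comp L H G (comp L K H z y) x = comp L K G z (comp K H G y x) := by
  have h1 : ∀ (W : Biset L K) (V : Biset K H),
      comp L H G (mk (W.comp V)) = (comp L K G (mk W)).comp (comp K H G (mk V)) := fun W V =>
    hom_ext fun U => by
      simp only [AddMonoidHom.comp_apply, comp_mk]
      exact mk_eq (Biset.assocIso W V U)
  have h2 : ∀ (W : Biset L K), ((comp L H G).comp (comp L K H (mk W))).flip x
      = (comp L K G (mk W)).comp ((comp K H G).flip x) := fun W => hom_ext fun V => by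
    simp only [AddMonoidHom.comp_apply, AddMonoidHom.flip_apply, comp_mk]
    exact DFunLike.congr_fun (h1 W V) x
  have h3 : ((comp L H G).flip x).comp ((comp L K H).flip y)
      = (comp L K G).flip (comp K H G y x) := hom_ext fun W => by
    simpa using DFunLike.congr_fun (h2 W) y
  simpa using DFunLike.congr_fun h3 z

end BisetBurnside

/-! ## The biset category -/

/-- The objects of the biset category: the finite groups. -/
structure BisetCat : Type (u + 1) where
  of ::
  carrier : Type u
  [group : Group carrier]
  [finite : Finite carrier]

namespace BisetCat

attribute [instance] BisetCat.group BisetCat.finite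

instance : CoeSort BisetCat.{u} (Type u) := ⟨BisetCat.carrier⟩

/-- The biset category over `ℤ`: the morphisms from `G` to `H` are the elements of `B(H, G)`, and
the composition is the bilinear extension of `(V, U) ↦ V ×_H U`. -/
instance : Category.{u + 1} BisetCat.{u} where
  Hom G H := BisetBurnside H G
  id G := BisetBurnside.mk (Biset.ofEquiv (MulEquiv.refl G))
  comp {G H K} f g := BisetBurnside.comp K H G g f
  id_comp f := BisetBurnside.comp_id f
  comp_id f := BisetBurnside.id_comp f
  assoc f g h := (BisetBurnside.comp_assoc h g f).symm

instance : Preadditive BisetCat.{u} where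
  homGroup G H := inferInstanceAs (AddCommGroup (BisetBurnside H G))
  add_comp G H K f f' g :=
    map_add (BisetBurnside.comp K H G g) (show BisetBurnside H G from f) f'
  comp_add G H K f g g' := DFunLike.congr_fun
    (map_add (BisetBurnside.comp K H G) (show BisetBurnside K H from g) g')
    (show BisetBurnside H G from f)

/-- The morphism `[U] : G ⟶ H` given by an `(H, G)`-biset `U`. -/
def homMk {G H : BisetCat.{u}} (U : Biset H G) : G ⟶ H := BisetBurnside.mk U

/-- The morphism `Iso(f)` given by a group isomorphism. -/
def isoMk {G H : BisetCat.{u}} (f : G ≃* H) : G ⟶ H := homMk (Biset.ofEquiv f)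

/-- The direct product of two finite groups. -/
def prod (G H : BisetCat.{u}) : BisetCat.{u} := of (G × H)

/-- The trivial group. -/
def trivial : BisetCat.{u} := of PUnit.{u + 1}

/-- The product of morphisms, the bilinear extension of `(U, V) ↦ U × V`. -/
def prodHom {G G' H H' : BisetCat.{u}} (φ : G ⟶ G') (ψ : H ⟶ H') :
    G.prod H ⟶ G'.prod H' :=
  BisetBurnside.prod G' G H' H φ ψ

end BisetCat

/-! ## Green biset functors -/

/-- The structure of a biset functor (a `ℤ`-linear functor from the biset category to
`ℤ`-modules) on a family of abelian groups indexed by the finite groups. -/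
structure BisetFunctor (A : BisetCat.{u} → Type v) [∀ G, AddCommGroup (A G)] where
  map : ∀ {G H : BisetCat.{u}}, (G ⟶ H) →+ (A G →+ A H)
  map_id : ∀ G : BisetCat.{u}, map (𝟙 G) = AddMonoidHom.id (A G)
  map_comp : ∀ {G H K : BisetCat.{u}} (φ : G ⟶ H) (ψ : H ⟶ K),
    map (φ ≫ ψ) = (map ψ).comp (map φ)

/-- The functor to `ℤ`-modules that underlies a biset functor. -/
def BisetFunctor.toFunctor {A : BisetCat.{u} → Type v} [∀ G, AddCommGroup (A G)]
    (F : BisetFunctor A) : BisetCat.{u} ⥤ ModuleCat.{v} ℤ where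
  obj G := ModuleCat.of ℤ (A G)
  map φ := ModuleCat.ofHom (F.map φ).toIntLinearMap
  map_id G := by
    rw [F.map_id]
    rfl
  map_comp φ ψ := by
    rw [F.map_comp]
    rfl

theorem BisetFunctor.toFunctor_additive {A : BisetCat.{u} → Type v} [∀ G, AddCommGroup (A G)]
    (F : BisetFunctor A) : F.toFunctor.Additive where
  map_add {G H φ ψ} := by
    simp only [toFunctor, map_add]
    rfl

/-- The structure of a Green biset functor on a family of abelian groups indexed by the finite
groups: a biset functor with bilinear products `A(G) × A(H) → A(G × H)` and an element of `A(1)`,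
subject to associativity, the identity laws and functoriality. -/
structure GreenBisetFunctor (A : BisetCat.{u} → Type v) [∀ G, AddCommGroup (A G)]
    extends BisetFunctor A where
  mul : ∀ {G H : BisetCat.{u}}, A G →+ A H →+ A (G.prod H)
  one : A BisetCat.trivial.{u}
  mul_assoc : ∀ {G H K : BisetCat.{u}} (a : A G) (b : A H) (c : A K),
    mul (mul a b) c =
      map (BisetCat.isoMk (G := G.prod (H.prod K)) (H := (G.prod H).prod K)
        (MulEquiv.prodAssoc (M := G) (N := H) (P := K)).symm) (mul a (mul b c))
  one_mul : ∀ {G : BisetCat.{u}} (a : A G),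
    map (BisetCat.isoMk (G := BisetCat.trivial.prod G) (H := G)
      (MulEquiv.uniqueProd (M := G) (N := PUnit.{u + 1}))) (mul one a) = a
  mul_one : ∀ {G : BisetCat.{u}} (a : A G),
    map (BisetCat.isoMk (G := G.prod BisetCat.trivial) (H := G)
      (MulEquiv.prodUnique (M := G) (N := PUnit.{u + 1}))) (mul a one) = a
  map_mul : ∀ {G G' H H' : BisetCat.{u}} (φ : G ⟶ G') (ψ : H ⟶ H') (a : A G) (b : A H),
    map (BisetCat.prodHom φ ψ) (mul a b) = mul (map φ a) (map ψ b)

/-- Morphisms of Green biset functors: natural transformations compatible with the products and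
the identity elements. -/
structure GreenBisetFunctor.Hom {A C : BisetCat.{u} → Type v} [∀ G, AddCommGroup (A G)]
    [∀ G, AddCommGroup (C G)] (S : GreenBisetFunctor A) (T : GreenBisetFunctor C) where
  app : ∀ G : BisetCat.{u}, A G →+ C G
  naturality : ∀ {G H : BisetCat.{u}} (φ : G ⟶ H) (a : A G),
    app H (S.map φ a) = T.map φ (app G a)
  map_mul : ∀ {G H : BisetCat.{u}} (a : A G) (b : A H),
    app (G.prod H) (S.mul a b) = T.mul (app G a) (app H b)
  map_one : app BisetCat.trivial S.one = T.one

/-! ## Finite `G`-sets and simplices -/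

/-- A finite `G`-set. -/
structure FinGSet (G : Type u) [Group G] : Type (u + 1) where
  of ::
  carrier : Type u
  [finite : Finite carrier]
  [action : MulAction G carrier]

namespace FinGSet

attribute [instance] FinGSet.finite FinGSet.action

variable {G H : Type u} [Group G] [Group H]

/-- Morphisms of `G`-sets: equivariant maps. -/
@[ext]
structure Hom (X Y : FinGSet G) where
  hom : X.carrier →[G] Y.carrier

instance : Category.{u} (FinGSet G) where
  Hom X Y := Hom X Y
  id X := ⟨MulActionHom.id G⟩
  comp f g := ⟨g.hom.comp f.hom⟩

@[simp] theorem id_hom_apply (X : FinGSet G) (x : X.carrier) : Hom.hom (𝟙 X) x = x := rfl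

@[simp] theorem comp_hom_apply {X Y Z : FinGSet G} (f : X ⟶ Y) (g : Y ⟶ Z) (x : X.carrier) :
    (f ≫ g).hom x = g.hom (f.hom x) := rfl

@[ext] theorem hom_ext {X Y : FinGSet G} {f g : X ⟶ Y} (h : ∀ x, f.hom x = g.hom x) : f = g :=
  Hom.ext (MulActionHom.ext h)

/-- The functor `X ↦ U ×_G X`, `f ↦ ((u, x) ↦ (u, f(x)))` from finite `G`-sets to finite
`H`-sets, for an `(H, G)`-biset `U`. -/
def tensor (U : Biset H G) : FinGSet G ⥤ FinGSet H where
  obj X := of (Tensor G U.carrier X.carrier)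
  map {X Y} f :=
    ⟨{ toFun := Tensor.desc (fun u x => Tensor.mk u (f.hom x)) (fun g u x => by
        rw [map_smul, Tensor.mk_op_smul])
       map_smul' := fun _ => Tensor.ind fun _ _ => rfl }⟩
  map_id _ := hom_ext (Tensor.ind fun _ _ => rfl)
  map_comp _ _ := hom_ext (Tensor.ind fun _ _ => rfl)

/-- The `G × H`-set `X × Y` with the componentwise action. -/
def prod (X : FinGSet G) (Y : FinGSet H) : FinGSet (G × H) :=
  letI : MulAction (G × H) (X.carrier × Y.carrier) :=
    { smul := fun g x => (g.1 • x.1, g.2 • x.2)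
      one_smul := fun x => Prod.ext (one_smul G x.1) (one_smul H x.2)
      mul_smul := fun a b x => Prod.ext (mul_smul a.1 b.1 x.1) (mul_smul a.2 b.2 x.2) }
  of (X.carrier × Y.carrier)

/-- The product of two equivariant maps. -/
def prodMap {X X' : FinGSet G} {Y Y' : FinGSet H} (f : X ⟶ X') (g : Y ⟶ Y') :
    X.prod Y ⟶ X'.prod Y' :=
  ⟨{ toFun := Prod.map f.hom g.hom
     map_smul' := fun k x => Prod.ext (map_smul f.hom k.1 x.1) (map_smul g.hom k.2 x.2) }⟩

/-- The `G`-set with one point. -/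
def point (G : Type u) [Group G] : FinGSet G :=
  letI : MulAction G PUnit.{u + 1} :=
    { smul := fun _ x => x
      one_smul := fun _ => rfl
      mul_smul := fun _ _ _ => rfl }
  of PUnit.{u + 1}

end FinGSet

/-- The `(n, G)`-simplices: chains `X₀ ⟶ X₁ ⟶ ⋯ ⟶ Xₙ` of finite `G`-sets, that is, the
`n`-simplices of the nerve of the category of finite `G`-sets. Their morphisms are the natural
transformations. -/
abbrev Simplex (n : ℕ) (G : Type u) [Group G] : Type (u + 1) := ComposableArrows (FinGSet G) n

namespace Simplex

variable {n : ℕ} {G H : Type u} [Group G] [Group H]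

/-- The `j`-th term of the subchain of `X` cut out by a `G`-invariant subset `A` of `Xᵢ`. -/
def RestrictObj (X : Simplex n G) (i : Fin (n + 1)) (A : SubMulAction G (X.obj i).carrier)
    (j : Fin (n + 1)) : Type u :=
  { x : (X.obj j).carrier // ∀ h : j ≤ i, (X.map (homOfLE h)).hom x ∈ A }

instance (X : Simplex n G) (i : Fin (n + 1)) (A : SubMulAction G (X.obj i).carrier)
    (j : Fin (n + 1)) : Finite (X.RestrictObj i A j) :=
  inferInstanceAs (Finite { _x : (X.obj j).carrier // _ })

instance (X : Simplex n G) (i : Fin (n + 1)) (A : SubMulAction G (X.obj i).carrier)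
    (j : Fin (n + 1)) : MulAction G (X.RestrictObj i A j) where
  smul g x := ⟨g • x.1, fun h => by
    rw [map_smul]
    exact A.smul_mem g (x.2 h)⟩
  one_smul x := Subtype.ext (one_smul G x.1)
  mul_smul a b x := Subtype.ext (mul_smul a b x.1)

/-- The subchain of `X` cut out by a `G`-invariant subset `A` of `Xᵢ`: the `j`-th term is the
preimage of `A` in `Xⱼ` for `j ≤ i`, and `Xⱼ` for `j > i`. -/
def restrict (X : Simplex n G) (i : Fin (n + 1)) (A : SubMulAction G (X.obj i).carrier) :
    Simplex n G where
  obj j := FinGSet.of (X.RestrictObj i A j)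
  map {j k} f :=
    ⟨{ toFun := fun (x : X.RestrictObj i A j) => (⟨(X.map f).hom x.1, fun h => by
        have h1 := x.2 ((leOfHom f).trans h)
        have h2 : (X.map (homOfLE h)).hom ((X.map f).hom x.1)
            = (X.map (homOfLE ((leOfHom f).trans h))).hom x.1 := by
          rw [← FinGSet.comp_hom_apply, ← X.map_comp]
          rfl
        rw [h2]
        exact h1⟩ : X.RestrictObj i A k)
       map_smul' := fun g (x : X.RestrictObj i A j) =>
        Subtype.ext (map_smul (X.map f).hom g x.1) }⟩
  map_id j := FinGSet.hom_ext fun x => Subtype.ext (by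
    change (X.map (𝟙 j)).hom x.1 = x.1
    rw [X.map_id]
    rfl)
  map_comp f g := FinGSet.hom_ext fun x => Subtype.ext (by
    change (X.map (f ≫ g)).hom x.1 = (X.map g).hom ((X.map f).hom x.1)
    rw [X.map_comp]
    rfl)

/-- The chain `U ×_G X₀ ⟶ U ×_G X₁ ⟶ ⋯ ⟶ U ×_G Xₙ`. -/
def tensor (U : Biset H G) (X : Simplex n G) : Simplex n H := X ⋙ FinGSet.tensor U

/-- The external product, the chain of the `G × H`-sets `Xᵢ × Yᵢ`. -/
def prod (X : Simplex n G) (Y : Simplex n H) : Simplex n (G × H) where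
  obj i := (X.obj i).prod (Y.obj i)
  map f := FinGSet.prodMap (X.map f) (Y.map f)
  map_id i := by rw [X.map_id, Y.map_id]; rfl
  map_comp f g := by rw [X.map_comp, Y.map_comp]; rfl

/-- The chain all of whose terms are the one-point `G`-set. -/
def point (n : ℕ) (G : Type u) [Group G] : Simplex n G :=
  (Functor.const (Fin (n + 1))).obj (FinGSet.point G)

/-- The face map: leave out `X_j`, composing the two adjacent maps if `0 < j < n + 1`. -/
def face (j : Fin (n + 2)) (X : Simplex (n + 1) G) : Simplex n G :=
  (nerve (FinGSet G)).δ j X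

/-- The degeneracy map: insert an identity map at `X_i`. -/
def degeneracy (i : Fin (n + 1)) (X : Simplex n G) : Simplex (n + 1) G :=
  (nerve (FinGSet G)).σ i X

end Simplex

/-- The triples `(X, A, B)` of `(n, G)`-simplices that come from a decomposition `Xᵢ = Aᵢ ⊔ Bᵢ`
into `G`-subsets, for some `i`. -/
def sliceRelations (n : ℕ) (G : Type u) [Group G] :
    Set (Simplex n G × Simplex n G × Simplex n G) :=
  {t | ∃ (X : Simplex n G) (i : Fin (n + 1)) (A B : SubMulAction G (X.obj i).carrier),
    IsCompl (A : Set (X.obj i).carrier) (B : Set (X.obj i).carrier) ∧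
      t = (X, X.restrict i A, X.restrict i B)}

/-- The `n`-simplicial Burnside group `Bₙ(G)`: the Grothendieck group of the isomorphism classes
of `(n, G)`-simplices with respect to the decompositions at some `Xᵢ`. -/
abbrev SimplicialBurnsideGroup (n : ℕ) (G : Type u) [Group G] : Type (u + 1) :=
  GrothendieckGroup (isIsomorphicSetoid (Simplex n G)) (sliceRelations n G)

/-- The image `π(X)` of an `(n, G)`-simplex in `Bₙ(G)`. -/
def pi {n : ℕ} {G : Type u} [Group G] (X : Simplex n G) : SimplicialBurnsideGroup n G :=
  GrothendieckGroup.mk _ _ X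

end SimplicialBurnside

open SimplicialBurnside

/-!
The structure maps are defined on classes of simplices by the prescribed formulas, and the point is
that they respect the relations `[X] = [A] + [B]`. To that end the relations are put in an
intrinsic form: `Simplex.IsSplitting i a b` says that two natural transformations `a : A ⟶ X` and
`b : B ⟶ X` exhibit `X` as the disjoint union of `A` and `B` in degrees at most `i` and are
bijective in the degrees above `i`. The subchains cut out by a decomposition of `Xᵢ` form such a
splitting (`Simplex.isSplitting_restrictι`), and conversely every splitting is of this form up to
isomorphism, so that it gives a relation (`Simplex.IsSplitting.pi_eq`).

The functor `U ×_G -` and the products `- × Y` and `X × -` preserve bijections and disjoint unions,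
hence preserve splittings. Additivity in `U` is the splitting of `(U ⊔ V) ×_G X` at the last index.
The laws of a Green biset functor then follow from bijections between the sets involved; since all
operations are multiadditive, it is enough to have them on generators.

Faces and degeneracies are pullbacks along monotone maps `Φ : Fin (m + 1) → Fin (n + 1)`. If
`Φ 0 = 0`, a splitting of `X` at `i` pulls back to a splitting at the largest `k` with `Φ k ≤ i`
(`Simplex.IsSplitting.whiskerLeft`). All codegeneracies satisfy this condition, and so do all
cofaces except the one that misses `0`, which is why `d₀` is excluded. Pullback commutes with the
biset action and the products on the nose, and the simplicial identities already hold in the nerve.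
-/

namespace SimplicialBurnside

/-! ### Generators of Grothendieck groups -/

@[elab_as_elim]
theorem GrothendieckGroup.induction_on {α : Type*} {r : Setoid α} {T : Set (α × α × α)}
    {P : GrothendieckGroup r T → Prop} (z : GrothendieckGroup r T)
    (zero : P 0) (mk : ∀ x, P (GrothendieckGroup.mk r T x)) (neg : ∀ a, P a → P (-a))
    (add : ∀ a b, P a → P b → P (a + b)) : P z := by
  obtain ⟨z, rfl⟩ := QuotientAddGroup.mk_surjective z
  induction z using FreeAbelianGroup.induction_on with
  | zero => exact zero
  | of q =>
    induction q using Quotient.inductionOn with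
    | h x => exact mk x
  | neg q ih => exact neg _ ih
  | add a b ha hb => exact add _ _ ha hb

namespace Simplex

variable {m n : ℕ} {G H K L : Type u} [Group G] [Group H] [Group K] [Group L]

/-! ### Classes of simplices -/

theorem pi_eq_of_bijective {X Y : Simplex n G} (f : X ⟶ Y)
    (hf : ∀ j, Function.Bijective (f.app j).hom) : pi X = pi Y := by
  have hinv : ∀ j, IsIso (f.app j) := fun j => by
    let e := Equiv.ofBijective _ (hf j)
    refine ⟨⟨⟨(f.app j).hom.inverse e.symm e.left_inv e.right_inv⟩, ?_, ?_⟩⟩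
    · exact FinGSet.hom_ext fun x => e.left_inv x
    · exact FinGSet.hom_ext fun x => e.right_inv x
  have := NatIso.isIso_of_isIso_app f
  exact GrothendieckGroup.mk_eq_of_rel ⟨asIso f⟩

/-- Two natural transformations `a : A ⟶ X` and `b : B ⟶ X` present `X` as split at the index `i`:
in degrees at most `i` they exhibit `X` as the disjoint union of `A` and `B`, and in degrees
above `i` both are bijective. -/
structure IsSplitting {X A B : Simplex n G} (i : Fin (n + 1)) (a : A ⟶ X) (b : B ⟶ X) : Prop where
  sum : ∀ j ≤ i, Function.Bijective (Sum.elim (a.app j).hom (b.app j).hom)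
  left : ∀ j, i < j → Function.Bijective (a.app j).hom
  right : ∀ j, i < j → Function.Bijective (b.app j).hom

theorem IsSplitting.symm {X A B : Simplex n G} {i : Fin (n + 1)} {a : A ⟶ X} {b : B ⟶ X}
    (h : IsSplitting i a b) : IsSplitting i b a where
  sum j hj := by
    have := (h.sum j hj).comp (Equiv.sumComm _ _).bijective
    rwa [show Sum.elim (a.app j).hom (b.app j).hom ∘ Equiv.sumComm _ _ =
      Sum.elim (b.app j).hom (a.app j).hom from funext fun x => by cases x <;> rfl] at this
  left := h.right
  right := h.left

/-- The image of an equivariant map, as an invariant subset. -/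
def imageSubset {X Y : FinGSet G} (f : X ⟶ Y) : SubMulAction G Y.carrier where
  carrier := Set.range f.hom
  smul_mem' := by
    rintro g _ ⟨x, rfl⟩
    exact ⟨g • x, map_smul f.hom g x⟩

theorem naturality_apply {X Y : Simplex n G} (a : X ⟶ Y) {j k : Fin (n + 1)} (f : j ⟶ k)
    (x : (X.obj j).carrier) :
    (a.app k).hom ((X.map f).hom x) = (Y.map f).hom ((a.app j).hom x) := by
  rw [← FinGSet.comp_hom_apply, a.naturality f, FinGSet.comp_hom_apply]

/-- In a splitting, the first part is the subchain cut out by its image in degree `i`. -/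
theorem IsSplitting.pi_restrict_left {X A B : Simplex n G} {i : Fin (n + 1)} {a : A ⟶ X}
    {b : B ⟶ X} (h : IsSplitting i a b) : pi A = pi (X.restrict i (imageSubset (a.app i))) := by
  let f : A ⟶ X.restrict i (imageSubset (a.app i)) :=
    { app := fun j =>
        ⟨{ toFun := fun x => (⟨(a.app j).hom x, fun hj =>
              ⟨(A.map (homOfLE hj)).hom x, naturality_apply a _ x⟩⟩ :
                X.RestrictObj i (imageSubset (a.app i)) j)
           map_smul' := fun g x => Subtype.ext (map_smul (a.app j).hom g x) }⟩
      naturality := fun j k g => FinGSet.hom_ext fun x =>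
        Subtype.ext (naturality_apply a g x) }
  refine pi_eq_of_bijective f fun j => ⟨fun x y hxy => ?_, fun ⟨y, hy⟩ => ?_⟩
  · have hxy' : (a.app j).hom x = (a.app j).hom y := congrArg Subtype.val hxy
    rcases le_or_gt j i with hj | hj
    · exact Sum.inl_injective ((h.sum j hj).1 hxy')
    · exact (h.left j hj).1 hxy'
  · rcases le_or_gt j i with hj | hj
    · obtain ⟨x | x, rfl⟩ := (h.sum j hj).2 y
      · exact ⟨x, rfl⟩
      · obtain ⟨z, hz⟩ := hy hj
        change (a.app i).hom z = (X.map _).hom ((b.app j).hom x) at hz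
        rw [← naturality_apply] at hz
        exact absurd ((h.sum i le_rfl).1 (a₁ := Sum.inl z) (a₂ := Sum.inr _) hz) Sum.inl_ne_inr
    · obtain ⟨x, rfl⟩ := (h.left j hj).2 y
      exact ⟨x, rfl⟩

theorem IsSplitting.pi_eq {X A B : Simplex n G} {i : Fin (n + 1)} {a : A ⟶ X} {b : B ⟶ X}
    (h : IsSplitting i a b) : pi X = pi A + pi B := by
  rw [h.pi_restrict_left, h.symm.pi_restrict_left]
  refine GrothendieckGroup.mk_eq_add ⟨X, i, _, _, ?_, rfl⟩
  have hb := h.sum i le_rfl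
  refine ⟨Set.disjoint_iff_forall_ne.2 ?_, codisjoint_iff.2 (Set.eq_univ_of_forall fun x => ?_)⟩
  · rintro _ ⟨x, rfl⟩ _ ⟨y, rfl⟩ hxy
    exact Sum.inl_ne_inr (hb.1 (a₁ := Sum.inl x) (a₂ := Sum.inr y) hxy)
  · obtain ⟨x | x, rfl⟩ := hb.2 x
    · exact Or.inl ⟨x, rfl⟩
    · exact Or.inr ⟨x, rfl⟩

/-- The inclusion of a subchain. -/
def restrictι (X : Simplex n G) (i : Fin (n + 1)) (A : SubMulAction G (X.obj i).carrier) :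
    X.restrict i A ⟶ X where
  app j := ⟨{ toFun := fun x : X.RestrictObj i A j => x.1, map_smul' := fun _ _ => rfl }⟩
  naturality _ _ _ := rfl

theorem restrictι_bijective (X : Simplex n G) {i : Fin (n + 1)}
    (A : SubMulAction G (X.obj i).carrier) {j : Fin (n + 1)} (hj : i < j) :
    Function.Bijective ((X.restrictι i A).app j).hom :=
  ⟨Subtype.val_injective, fun x => ⟨⟨x, fun h => absurd h hj.not_ge⟩, rfl⟩⟩

theorem isSplitting_restrictι (X : Simplex n G) {i : Fin (n + 1)}
    {A B : SubMulAction G (X.obj i).carrier}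
    (h : IsCompl (A : Set (X.obj i).carrier) (B : Set (X.obj i).carrier)) :
    IsSplitting i (X.restrictι i A) (X.restrictι i B) where
  sum j hj := by
    constructor
    · refine Function.Injective.sumElim Subtype.val_injective Subtype.val_injective ?_
      rintro ⟨x, hx⟩ ⟨y, hy⟩ hxy
      obtain rfl : x = y := hxy
      exact Set.disjoint_left.1 h.disjoint (hx hj) (hy hj)
    · intro x
      rcases h.sup_eq_top.ge (Set.mem_univ ((X.map (homOfLE hj)).hom x)) with hx | hx
      · exact ⟨Sum.inl ⟨x, fun _ => hx⟩, rfl⟩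
      · exact ⟨Sum.inr ⟨x, fun _ => hx⟩, rfl⟩
  left _ := restrictι_bijective X A
  right _ := restrictι_bijective X B

theorem exists_isSplitting {t : Simplex n G × Simplex n G × Simplex n G}
    (ht : t ∈ sliceRelations n G) :
    ∃ (i : Fin (n + 1)) (a : t.2.1 ⟶ t.1) (b : t.2.2 ⟶ t.1), IsSplitting i a b := by
  obtain ⟨X, i, A, B, h, rfl⟩ := ht
  exact ⟨i, X.restrictι i A, X.restrictι i B, X.isSplitting_restrictι h⟩

theorem pi_eq_of_iso {X Y : Simplex n G} (e : X ≅ Y) : pi X = pi Y :=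
  GrothendieckGroup.mk_eq_of_rel ⟨e⟩

theorem bijective_of_eq {α β : Type*} {f g : α → β} (hf : Function.Bijective f)
    (h : ∀ x, f x = g x) : Function.Bijective g :=
  funext h ▸ hf

/-! ### The action of bisets -/

/-- A bijective map of `G`-sets induces a bijective map on `U ×_G -`. -/
theorem tensor_map_bijective (U : Biset H G) {X Y : FinGSet G} (f : X ⟶ Y)
    (hf : Function.Bijective f.hom) : Function.Bijective ((FinGSet.tensor U).map f).hom := by
  have h := (Tensor.congr (H := G) (Equiv.refl U.carrier) (Equiv.ofBijective _ hf)
    (fun _ _ => rfl) (fun g x => map_smul f.hom g x)).bijective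
  exact bijective_of_eq h (Tensor.ind fun _ _ => rfl)

theorem tensor_sum_bijective (U : Biset H G) {X A B : FinGSet G} (a : A ⟶ X) (b : B ⟶ X)
    (h : Function.Bijective (Sum.elim a.hom b.hom)) :
    Function.Bijective (Sum.elim ((FinGSet.tensor U).map a).hom ((FinGSet.tensor U).map b).hom) := by
  refine bijective_of_eq ((Tensor.sumRight G U.carrier A.carrier B.carrier).symm.trans
    (Tensor.congr (Equiv.refl U.carrier) (Equiv.ofBijective _ h) (fun _ _ => rfl) (by
      rintro g (x | x)
      · exact map_smul a.hom g x
      · exact map_smul b.hom g x))).bijective fun t => ?_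
  rcases t with t | t <;> induction t using Tensor.ind <;> rfl

theorem IsSplitting.tensor (U : Biset H G) {X A B : Simplex n G} {i : Fin (n + 1)} {a : A ⟶ X}
    {b : B ⟶ X} (h : IsSplitting i a b) :
    IsSplitting (X := X.tensor U) (A := A.tensor U) (B := B.tensor U) i
      (Functor.whiskerRight a (FinGSet.tensor U)) (Functor.whiskerRight b (FinGSet.tensor U)) where
  sum j hj := tensor_sum_bijective U _ _ (h.sum j hj)
  left j hj := tensor_map_bijective U _ (h.left j hj)
  right j hj := tensor_map_bijective U _ (h.right j hj)

/-- Naturality of `U ×_G X` in the biset `U`. -/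
def tensorMapLeft {U V : Biset H G} (f : U.carrier → V.carrier)
    (hl : ∀ (h : H) u, f (h • u) = h • f u) (hr : ∀ (g : G) u, f (op g • u) = op g • f u)
    (X : Simplex n G) : X.tensor U ⟶ X.tensor V where
  app _ := ⟨{
    toFun := Tensor.desc (fun u x => Tensor.mk (f u) x) fun g u x => by
      rw [hr, Tensor.mk_op_smul]
    map_smul' := fun h => Tensor.ind fun u x =>
      congrArg (fun v => (Tensor.mk v x : Tensor G V.carrier _)) (hl h u) }⟩
  naturality _ _ _ := FinGSet.hom_ext (Tensor.ind fun _ _ => rfl)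

theorem pi_tensor_congr {U V : Biset H G} (e : Biset.Iso U V) (X : Simplex n G) :
    pi (X.tensor U) = pi (X.tensor V) :=
  pi_eq_of_bijective (tensorMapLeft e.toEquiv e.map_left e.map_right X) fun _ =>
    (Tensor.congr e.toEquiv (Equiv.refl _) e.map_right fun _ _ => rfl).bijective

/-- Additivity in the biset: a disjoint union of bisets splits `U ×_G X` at the last index, that
is, in every degree. -/
theorem isSplitting_tensor_sum (U V : Biset H G) (X : Simplex n G) :
    IsSplitting (Fin.last n)
      (tensorMapLeft (U := U) (V := U.sum V) Sum.inl (fun _ _ => rfl) (fun _ _ => rfl) X)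
      (tensorMapLeft (U := V) (V := U.sum V) Sum.inr (fun _ _ => rfl) (fun _ _ => rfl) X) where
  sum j _ := by
    refine bijective_of_eq (Tensor.sumLeft G U.carrier V.carrier (X.obj j).carrier).symm.bijective
      fun t => ?_
    rcases t with t | t <;> induction t using Tensor.ind <;> rfl
  left j hj := absurd hj (Fin.le_last j).not_gt
  right j hj := absurd hj (Fin.le_last j).not_gt

/-- `B_n([U])`, biadditively in `[U]` and the simplex. -/
def tensorHom (n : ℕ) (H G : Type u) [Group H] [Group G] :
    BisetBurnside H G →+ SimplicialBurnsideGroup n G →+ SimplicialBurnsideGroup n H :=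
  GrothendieckGroup.lift₂ (fun U X => pi (X.tensor U))
    (fun _ _ X ⟨e⟩ => pi_tensor_congr e X)
    (fun U _ _ ⟨e⟩ => pi_eq_of_iso (Functor.isoWhiskerRight e (FinGSet.tensor U)))
    (by
      rintro _ ⟨U, V, rfl⟩ X
      exact (isSplitting_tensor_sum U V X).pi_eq)
    (fun U t ht => by
      obtain ⟨i, a, b, h⟩ := exists_isSplitting ht
      exact (h.tensor U).pi_eq)

@[simp] theorem tensorHom_mk_pi (U : Biset H G) (X : Simplex n G) :
    tensorHom n H G (BisetBurnside.mk U) (pi X) = pi (X.tensor U) :=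
  GrothendieckGroup.lift₂_mk _ _ _ _ _ _ _

/-- For a group isomorphism `f`, the chain `Iso(f) ×_G X` is `X` with the action transported
along `f`. -/
theorem pi_tensor_ofEquiv [Finite H] (f : G ≃* H) {X : Simplex n G} {Y : Simplex n H}
    (e : ∀ j, (X.obj j).carrier ≃ (Y.obj j).carrier)
    (he : ∀ j (g : G) x, e j (g • x) = f g • e j x)
    (hn : ∀ {j k} (φ : j ⟶ k) x, e k ((X.map φ).hom x) = (Y.map φ).hom (e j x)) :
    pi (X.tensor (Biset.ofEquiv f)) = pi Y := by
  let F : X.tensor (Biset.ofEquiv f) ⟶ Y :=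
    { app := fun j => ⟨{
        toFun := Tensor.desc (fun (h : H) x => h • e j x) fun g (h : H) x => by
          change (h * f g) • e j x = h • e j (g • x)
          rw [he, mul_smul]
        map_smul' := fun k => Tensor.ind fun (h : H) x => mul_smul k h (e j x) }⟩
      naturality := fun j k φ => FinGSet.hom_ext (Tensor.ind fun (h : H) x => by
        change h • e k ((X.map φ).hom x) = (Y.map φ).hom (h • e j x)
        rw [hn, map_smul]) }
  refine pi_eq_of_bijective F fun j => Function.bijective_iff_has_inverse.2
    ⟨fun y => Tensor.mk (V := (Biset.ofEquiv f).carrier) (1 : H) ((e j).symm y),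
      Tensor.ind fun (h : H) x => ?_, fun y => ?_⟩
  · -- `h ⊗ x = 1 ⊗ f⁻¹(h) x`
    obtain ⟨g, rfl⟩ := f.surjective h
    change Tensor.mk (V := (Biset.ofEquiv f).carrier) (1 : H) ((e j).symm (f g • e j x)) = _
    rw [← he, Equiv.symm_apply_apply]
    refine (Tensor.mk_op_smul g (V := (Biset.ofEquiv f).carrier) (1 : H) x).symm.trans ?_
    exact congrArg (fun w => Tensor.mk (V := (Biset.ofEquiv f).carrier) w x) (one_mul (f g))
  · exact (one_smul H (e j ((e j).symm y))).trans ((e j).apply_symm_apply y)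

theorem pi_tensor_id [Finite G] (X : Simplex n G) :
    pi (X.tensor (Biset.ofEquiv (MulEquiv.refl G))) = pi X :=
  pi_tensor_ofEquiv _ (fun _ => Equiv.refl _) (fun _ _ _ => rfl) (fun _ _ => rfl)

theorem pi_tensor_comp (V : Biset K H) (U : Biset H G) (X : Simplex n G) :
    pi (X.tensor (V.comp U)) = pi ((X.tensor U).tensor V) := by
  let F : X.tensor (V.comp U) ⟶ (X.tensor U).tensor V :=
    { app := fun j => ⟨{
        toFun := Tensor.assoc H G V.carrier U.carrier (X.obj j).carrier
        map_smul' := fun k => Tensor.ind fun t x => by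
          change Tensor H V.carrier U.carrier at t
          induction t using Tensor.ind; rfl }⟩
      naturality := fun j k φ => FinGSet.hom_ext (Tensor.ind fun t x => by
        change Tensor H V.carrier U.carrier at t
        induction t using Tensor.ind; rfl) }
  exact pi_eq_of_bijective F fun j => (Tensor.assoc _ _ _ _ _).bijective

/-! ### External products -/

/-- The product of two morphisms of simplices. -/
def prodMap {X X' : Simplex n G} {Y Y' : Simplex n H} (a : X ⟶ X') (b : Y ⟶ Y') :
    X.prod Y ⟶ X'.prod Y' where
  app j := FinGSet.prodMap (a.app j) (b.app j)
  naturality _ _ φ := FinGSet.hom_ext fun x =>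
    Prod.ext (naturality_apply a φ x.1) (naturality_apply b φ x.2)

theorem pi_prod_congr {X X' : Simplex n G} {Y Y' : Simplex n H} (e : X ≅ X') (f : Y ≅ Y') :
    pi (X.prod Y) = pi (X'.prod Y') :=
  pi_eq_of_iso
    { hom := prodMap e.hom f.hom
      inv := prodMap e.inv f.inv
      hom_inv_id := NatTrans.ext <| funext fun j => FinGSet.hom_ext fun x => Prod.ext
        (by exact congrArg (fun a => FinGSet.Hom.hom a x.1) (e.hom_inv_id_app j))
        (by exact congrArg (fun a => FinGSet.Hom.hom a x.2) (f.hom_inv_id_app j))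
      inv_hom_id := NatTrans.ext <| funext fun j => FinGSet.hom_ext fun x => Prod.ext
        (by exact congrArg (fun a => FinGSet.Hom.hom a x.1) (e.inv_hom_id_app j))
        (by exact congrArg (fun a => FinGSet.Hom.hom a x.2) (f.inv_hom_id_app j)) }

theorem IsSplitting.prod_right {X A B : Simplex n G} {i : Fin (n + 1)} {a : A ⟶ X} {b : B ⟶ X}
    (h : IsSplitting i a b) (Y : Simplex n H) :
    IsSplitting i (prodMap a (𝟙 Y)) (prodMap b (𝟙 Y)) where
  sum j hj := by
    refine bijective_of_eq (((h.sum j hj).prodMap Function.bijective_id).comp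
      (Equiv.sumProdDistrib _ _ (Y.obj j).carrier).symm.bijective) fun x => ?_
    rcases x with x | x <;> rfl
  left j hj := (h.left j hj).prodMap Function.bijective_id
  right j hj := (h.right j hj).prodMap Function.bijective_id

theorem IsSplitting.prod_left {Y A B : Simplex n H} {i : Fin (n + 1)} {a : A ⟶ Y} {b : B ⟶ Y}
    (h : IsSplitting i a b) (X : Simplex n G) :
    IsSplitting i (prodMap (𝟙 X) a) (prodMap (𝟙 X) b) where
  sum j hj := by
    refine bijective_of_eq (((Function.bijective_id (α := (X.obj j).carrier)).prodMap (h.sum j hj)).comp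
      (Equiv.prodSumDistrib _ _ _).symm.bijective) fun x => ?_
    rcases x with x | x <;> rfl
  left j hj := Function.bijective_id.prodMap (h.left j hj)
  right j hj := Function.bijective_id.prodMap (h.right j hj)

/-- The biadditive extension of the external product of simplices. -/
def prodHom (n : ℕ) (G H : Type u) [Group G] [Group H] :
    SimplicialBurnsideGroup n G →+ SimplicialBurnsideGroup n H →+
      SimplicialBurnsideGroup n (G × H) :=
  GrothendieckGroup.lift₂ (fun X Y => pi (X.prod Y))
    (fun _ _ Y ⟨e⟩ => pi_prod_congr e (Iso.refl Y))
    (fun X _ _ ⟨e⟩ => pi_prod_congr (Iso.refl X) e)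
    (fun t ht Y => by
      obtain ⟨i, a, b, h⟩ := exists_isSplitting ht
      exact (h.prod_right Y).pi_eq)
    (fun X t ht => by
      obtain ⟨i, a, b, h⟩ := exists_isSplitting ht
      exact (h.prod_left X).pi_eq)

@[simp] theorem prodHom_pi_pi (X : Simplex n G) (Y : Simplex n H) :
    prodHom n G H (pi X) (pi Y) = pi (X.prod Y) :=
  GrothendieckGroup.lift₂_mk _ _ _ _ _ _ _

theorem pi_prod_assoc [Finite G] [Finite H] [Finite K] (X : Simplex n G) (Y : Simplex n H)
    (Z : Simplex n K) :
    pi ((X.prod (Y.prod Z)).tensor (Biset.ofEquiv (MulEquiv.prodAssoc (M := G) (N := H)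
      (P := K)).symm)) = pi ((X.prod Y).prod Z) :=
  pi_tensor_ofEquiv _ (fun _ => (Equiv.prodAssoc _ _ _).symm) (fun _ _ _ => rfl) (fun _ _ => rfl)

theorem pi_point_prod [Finite G] (X : Simplex n G) :
    pi (((point n PUnit.{u + 1}).prod X).tensor (Biset.ofEquiv (MulEquiv.uniqueProd (M := G)
      (N := PUnit.{u + 1})))) = pi X :=
  pi_tensor_ofEquiv _ (fun j => Equiv.punitProd (X.obj j).carrier) (fun _ _ _ => rfl)
    (fun _ _ => rfl)

theorem pi_prod_point [Finite G] (X : Simplex n G) :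
    pi ((X.prod (point n PUnit.{u + 1})).tensor (Biset.ofEquiv (MulEquiv.prodUnique (M := G)
      (N := PUnit.{u + 1})))) = pi X :=
  pi_tensor_ofEquiv _ (fun j => Equiv.prodPUnit (X.obj j).carrier) (fun _ _ _ => rfl)
    (fun _ _ => rfl)

/-- `(U × V) ×_{G × L} (X × Y) = (U ×_G X) × (V ×_L Y)`. -/
theorem pi_prod_tensor_prod (U : Biset H G) (V : Biset K L) (X : Simplex n G) (Y : Simplex n L) :
    pi ((X.prod Y).tensor (U.prod V)) = pi ((X.tensor U).prod (Y.tensor V)) := by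
  let F : (X.prod Y).tensor (U.prod V) ⟶ (X.tensor U).prod (Y.tensor V) :=
    { app := fun j => ⟨{
        toFun := Tensor.desc (fun (u : U.carrier × V.carrier)
            (x : (X.obj j).carrier × (Y.obj j).carrier) =>
              ((Tensor.mk u.1 x.1, Tensor.mk u.2 x.2) :
                Tensor G U.carrier (X.obj j).carrier × Tensor L V.carrier (Y.obj j).carrier))
          fun g u x => Prod.ext (Tensor.mk_op_smul g.1 u.1 x.1) (Tensor.mk_op_smul g.2 u.2 x.2)
        map_smul' := fun _ => Tensor.ind fun _ _ => rfl }⟩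
      naturality := fun j k φ => FinGSet.hom_ext (Tensor.ind fun _ _ => rfl) }
  refine pi_eq_of_bijective F fun j => ⟨fun s t => ?_, ?_⟩
  · induction s using Tensor.ind with
    | h u x =>
    induction t using Tensor.ind with
    | h u' x' =>
    intro h
    -- the two components are moved by independent group elements
    obtain ⟨g, hg⟩ := Quotient.exact (congrArg Prod.fst h)
    obtain ⟨l, hl⟩ := Quotient.exact (congrArg Prod.snd h)
    refine Quotient.sound ⟨(g, l), Prod.ext ?_ ?_⟩
    · exact Prod.ext (congrArg Prod.fst hg :) (congrArg Prod.fst hl :)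
    · exact Prod.ext (congrArg Prod.snd hg :) (congrArg Prod.snd hl :)
  · rintro ⟨s, t⟩
    change Tensor G U.carrier (X.obj j).carrier at s
    change Tensor L V.carrier (Y.obj j).carrier at t
    induction s using Tensor.ind with
    | h u x =>
    induction t using Tensor.ind with
    | h v y =>
    exact ⟨Tensor.mk (H := G × L) (V := (U.prod V).carrier) (U := ((X.obj j).prod (Y.obj j)).carrier)
      (u, v) (x, y), rfl⟩

/-! ### Pulling back along monotone maps -/

/-- The largest index that `Φ` sends below `i`. -/
theorem exists_le_iff_obj_le (Φ : Fin (m + 1) ⥤ Fin (n + 1)) (h0 : Φ.obj 0 = 0)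
    (i : Fin (n + 1)) : ∃ k, ∀ j, j ≤ k ↔ Φ.obj j ≤ i := by
  obtain ⟨k, hk, hmax⟩ := Finset.exists_max_image (Finset.univ.filter fun j => Φ.obj j ≤ i) id
    ⟨0, by simp [h0]⟩
  refine ⟨k, fun j => ⟨fun hj => ?_, fun hj => hmax j (by simpa using hj)⟩⟩
  exact (leOfHom (Φ.map (homOfLE hj))).trans (by simpa using hk)

/-- A splitting of `X` at `i` pulls back to a splitting at the largest `k` with `Φ k ≤ i`; such a
`k` exists because `Φ` preserves the first vertex. -/
theorem IsSplitting.whiskerLeft (Φ : Fin (m + 1) ⥤ Fin (n + 1)) (h0 : Φ.obj 0 = 0)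
    {X A B : Simplex n G} {i : Fin (n + 1)} {a : A ⟶ X} {b : B ⟶ X} (h : IsSplitting i a b) :
    ∃ k, IsSplitting (X := Φ ⋙ X) (A := Φ ⋙ A) (B := Φ ⋙ B) k
      (Functor.whiskerLeft Φ a) (Functor.whiskerLeft Φ b) := by
  obtain ⟨k, hk⟩ := exists_le_iff_obj_le Φ h0 i
  have hk' : ∀ j, k < j → i < Φ.obj j := fun j hj => by
    rw [← not_le] at hj ⊢
    exact fun h => hj ((hk j).2 h)
  exact ⟨k, fun j hj => h.sum _ ((hk j).1 hj), fun j hj => h.left _ (hk' j hj),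
    fun j hj => h.right _ (hk' j hj)⟩

/-- The homomorphism `B_n(G) → B_m(G)` induced by a monotone map `Fin (m + 1) → Fin (n + 1)` that
preserves the first vertex. -/
def pullHom (Φ : Fin (m + 1) ⥤ Fin (n + 1)) (h0 : Φ.obj 0 = 0) (G : Type u) [Group G] :
    SimplicialBurnsideGroup n G →+ SimplicialBurnsideGroup m G :=
  GrothendieckGroup.lift (fun X => pi (Φ ⋙ X : Simplex m G))
    (fun _ _ ⟨e⟩ => pi_eq_of_iso (Functor.isoWhiskerLeft Φ e))
    (fun t ht => by
      obtain ⟨i, a, b, h⟩ := exists_isSplitting ht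
      obtain ⟨k, hk⟩ := h.whiskerLeft Φ h0
      exact hk.pi_eq)

@[simp] theorem pullHom_pi (Φ : Fin (m + 1) ⥤ Fin (n + 1)) (h0 : Φ.obj 0 = 0) (X : Simplex n G) :
    pullHom Φ h0 G (pi X) = pi (Φ ⋙ X : Simplex m G) :=
  GrothendieckGroup.lift_mk _ _ _ _

end Simplex

/-! ### The Green biset functor structure -/

namespace Simplex

variable {m n : ℕ}

theorem tensorHom_id (G : Type u) [Group G] [Finite G] :
    tensorHom n G G (BisetBurnside.mk (Biset.ofEquiv (MulEquiv.refl G))) = AddMonoidHom.id _ :=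
  GrothendieckGroup.hom_ext fun X => (tensorHom_mk_pi _ X).trans (pi_tensor_id X)

theorem tensorHom_comp {K H G : Type u} [Group K] [Group H] [Group G]
    (y : BisetBurnside K H) (x : BisetBurnside H G) :
    tensorHom n K G (BisetBurnside.comp K H G y x) =
      (tensorHom n K H y).comp (tensorHom n H G x) := by
  refine GrothendieckGroup.hom_ext fun X => ?_
  induction y using GrothendieckGroup.induction_on with
  | zero => simp
  | neg y hy => simpa using hy
  | add y y' hy hy' => simpa using congrArg₂ (· + ·) hy hy'
  | mk V =>
  induction x using GrothendieckGroup.induction_on with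
  | zero => simp
  | neg x hx => simpa using hx
  | add x x' hx hx' => simpa using congrArg₂ (· + ·) hx hx'
  | mk U =>
  change tensorHom n K G (BisetBurnside.comp K H G (BisetBurnside.mk V) (BisetBurnside.mk U))
    (pi X) = tensorHom n K H (BisetBurnside.mk V) (tensorHom n H G (BisetBurnside.mk U) (pi X))
  simp only [BisetBurnside.comp_mk, tensorHom_mk_pi, pi_tensor_comp]

theorem prodHom_assoc {G H K : Type u} [Group G] [Group H] [Group K] [Finite G] [Finite H]
    [Finite K] (a : SimplicialBurnsideGroup n G) (b : SimplicialBurnsideGroup n H)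
    (c : SimplicialBurnsideGroup n K) :
    prodHom n (G × H) K (prodHom n G H a b) c =
      tensorHom n _ _ (BisetBurnside.mk (Biset.ofEquiv (MulEquiv.prodAssoc (M := G) (N := H)
        (P := K)).symm)) (prodHom n G (H × K) a (prodHom n H K b c)) := by
  induction a using GrothendieckGroup.induction_on with
  | zero => simp
  | neg a ha => simpa using ha
  | add a a' ha ha' => simpa using congrArg₂ (· + ·) ha ha'
  | mk X =>
  induction b using GrothendieckGroup.induction_on with
  | zero => simp
  | neg b hb => simpa using hb
  | add b b' hb hb' => simpa using congrArg₂ (· + ·) hb hb'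
  | mk Y =>
  induction c using GrothendieckGroup.induction_on with
  | zero => simp
  | neg c hc => simpa using hc
  | add c c' hc hc' => simpa using congrArg₂ (· + ·) hc hc'
  | mk Z =>
  change prodHom n (G × H) K (prodHom n G H (pi X) (pi Y)) (pi Z) =
    tensorHom n _ _ _ (prodHom n G (H × K) (pi X) (prodHom n H K (pi Y) (pi Z)))
  simp only [prodHom_pi_pi, tensorHom_mk_pi, pi_prod_assoc]

theorem point_prodHom {G : Type u} [Group G] [Finite G] (a : SimplicialBurnsideGroup n G) :
    tensorHom n _ _ (BisetBurnside.mk (Biset.ofEquiv (MulEquiv.uniqueProd (M := G)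
      (N := PUnit.{u + 1})))) (prodHom n _ G (pi (point n PUnit.{u + 1})) a) = a := by
  induction a using GrothendieckGroup.induction_on with
  | zero => simp
  | neg a ha => simpa using ha
  | add a a' ha ha' => simpa using congrArg₂ (· + ·) ha ha'
  | mk X =>
  change tensorHom n _ _ _ (prodHom n _ G _ (pi X)) = pi X
  simp only [prodHom_pi_pi, tensorHom_mk_pi, pi_point_prod]

theorem prodHom_point {G : Type u} [Group G] [Finite G] (a : SimplicialBurnsideGroup n G) :
    tensorHom n _ _ (BisetBurnside.mk (Biset.ofEquiv (MulEquiv.prodUnique (M := G)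
      (N := PUnit.{u + 1})))) (prodHom n G _ a (pi (point n PUnit.{u + 1}))) = a := by
  induction a using GrothendieckGroup.induction_on with
  | zero => simp
  | neg a ha => simpa using ha
  | add a a' ha ha' => simpa using congrArg₂ (· + ·) ha ha'
  | mk X =>
  change tensorHom n _ _ _ (prodHom n G _ (pi X) _) = pi X
  simp only [prodHom_pi_pi, tensorHom_mk_pi, pi_prod_point]

theorem tensorHom_prod_prodHom {G G' H H' : Type u} [Group G] [Group G'] [Group H] [Group H']
    (φ : BisetBurnside G' G) (ψ : BisetBurnside H' H)
    (a : SimplicialBurnsideGroup n G) (b : SimplicialBurnsideGroup n H) :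
    tensorHom n _ _ (BisetBurnside.prod G' G H' H φ ψ) (prodHom n G H a b) =
      prodHom n G' H' (tensorHom n _ _ φ a) (tensorHom n _ _ ψ b) := by
  induction φ using GrothendieckGroup.induction_on with
  | zero => simp
  | neg φ hφ => simpa using hφ
  | add φ φ' hφ hφ' => simpa using congrArg₂ (· + ·) hφ hφ'
  | mk U =>
  induction ψ using GrothendieckGroup.induction_on with
  | zero => simp
  | neg ψ hψ => simpa using hψ
  | add ψ ψ' hψ hψ' => simpa using congrArg₂ (· + ·) hψ hψ'
  | mk V =>
  induction a using GrothendieckGroup.induction_on with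
  | zero => simp
  | neg a ha => simpa using ha
  | add a a' ha ha' => simpa using congrArg₂ (· + ·) ha ha'
  | mk X =>
  induction b using GrothendieckGroup.induction_on with
  | zero => simp
  | neg b hb => simpa using hb
  | add b b' hb hb' => simpa using congrArg₂ (· + ·) hb hb'
  | mk Y =>
  change tensorHom n _ _ (BisetBurnside.prod G' G H' H (BisetBurnside.mk U) (BisetBurnside.mk V))
    (prodHom n G H (pi X) (pi Y)) = prodHom n G' H' (tensorHom n _ _ (BisetBurnside.mk U) (pi X))
      (tensorHom n _ _ (BisetBurnside.mk V) (pi Y))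
  simp only [BisetBurnside.prod_mk, prodHom_pi_pi, tensorHom_mk_pi, pi_prod_tensor_prod]

theorem pullHom_tensorHom (Φ : Fin (m + 1) ⥤ Fin (n + 1)) (h0 : Φ.obj 0 = 0) {G H : Type u}
    [Group G] [Group H] (φ : BisetBurnside H G) (a : SimplicialBurnsideGroup n G) :
    pullHom Φ h0 H (tensorHom n H G φ a) = tensorHom m H G φ (pullHom Φ h0 G a) := by
  induction φ using GrothendieckGroup.induction_on with
  | zero => simp
  | neg φ hφ => simpa using hφ
  | add φ φ' hφ hφ' => simpa using congrArg₂ (· + ·) hφ hφ'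
  | mk U =>
  induction a using GrothendieckGroup.induction_on with
  | zero => simp
  | neg a ha => simpa using ha
  | add a a' ha ha' => simpa using congrArg₂ (· + ·) ha ha'
  | mk X =>
  change pullHom Φ h0 H (tensorHom n H G (BisetBurnside.mk U) (pi X)) =
    tensorHom m H G (BisetBurnside.mk U) (pullHom Φ h0 G (pi X))
  simp only [tensorHom_mk_pi, pullHom_pi]
  rfl

theorem pullHom_prodHom (Φ : Fin (m + 1) ⥤ Fin (n + 1)) (h0 : Φ.obj 0 = 0) {G H : Type u}
    [Group G] [Group H] (a : SimplicialBurnsideGroup n G) (b : SimplicialBurnsideGroup n H) :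
    pullHom Φ h0 (G × H) (prodHom n G H a b) =
      prodHom m G H (pullHom Φ h0 G a) (pullHom Φ h0 H b) := by
  induction a using GrothendieckGroup.induction_on with
  | zero => simp
  | neg a ha => simpa using ha
  | add a a' ha ha' => simpa using congrArg₂ (· + ·) ha ha'
  | mk X =>
  induction b using GrothendieckGroup.induction_on with
  | zero => simp
  | neg b hb => simpa using hb
  | add b b' hb hb' => simpa using congrArg₂ (· + ·) hb hb'
  | mk Y =>
  change pullHom Φ h0 (G × H) (prodHom n G H (pi X) (pi Y)) =
    prodHom m G H (pullHom Φ h0 G (pi X)) (pullHom Φ h0 H (pi Y))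
  simp only [prodHom_pi_pi, pullHom_pi]
  rfl

end Simplex

open Simplex

/-- The Green biset functor `B_n`. -/
def simplicialBurnside (n : ℕ) :
    GreenBisetFunctor (fun G : BisetCat.{u} => SimplicialBurnsideGroup n G) where
  map {G H} := tensorHom n H G
  map_id G := tensorHom_id G
  map_comp φ ψ := tensorHom_comp ψ φ
  mul {G H} := prodHom n G H
  one := pi (point n PUnit.{u + 1})
  mul_assoc a b c := prodHom_assoc a b c
  one_mul a := point_prodHom a
  mul_one a := prodHom_point a
  map_mul φ ψ a b := tensorHom_prod_prodHom φ ψ a b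

/-- The morphism `B_n → B_m` induced by a monotone map that preserves the first vertex. -/
def pullGreenHom {m n : ℕ} (Φ : Fin (m + 1) ⥤ Fin (n + 1)) (h0 : Φ.obj 0 = 0) :
    (simplicialBurnside.{u} n).Hom (simplicialBurnside.{u} m) where
  app G := pullHom Φ h0 G
  naturality φ a := pullHom_tensorHom Φ h0 φ a
  map_mul a b := pullHom_prodHom Φ h0 a b
  map_one := pullHom_pi Φ h0 _

/-- The face map `d_j` for `j ≠ 0`; the coface map `δ_j` preserves the first vertex. -/
def faceHom (n : ℕ) (j : Fin (n + 2)) (hj : j ≠ 0) :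
    (simplicialBurnside.{u} (n + 1)).Hom (simplicialBurnside.{u} n) :=
  pullGreenHom (SimplexCategory.toCat.map (SimplexCategory.δ j)).toFunctor
    (Fin.succAbove_ne_zero_zero hj)

/-- The degeneracy map `s_i`. -/
def degeneracyHom (n : ℕ) (i : Fin (n + 1)) :
    (simplicialBurnside.{u} n).Hom (simplicialBurnside.{u} (n + 1)) :=
  pullGreenHom (SimplexCategory.toCat.map (SimplexCategory.σ i)).toFunctor
    (Fin.predAbove_right_zero (i := i))

section

variable {n : ℕ} {G : BisetCat.{u}}

theorem faceHom_pi (j : Fin (n + 2)) (hj : j ≠ 0) (X : Simplex (n + 1) G) :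
    (faceHom n j hj).app G (pi X) = pi (X.face j) :=
  pullHom_pi _ (Fin.succAbove_ne_zero_zero hj) X

theorem degeneracyHom_pi (i : Fin (n + 1)) (X : Simplex n G) :
    (degeneracyHom n i).app G (pi X) = pi (X.degeneracy i) :=
  pullHom_pi _ (Fin.predAbove_right_zero (i := i)) X

/-! ### The simplicial identities -/

/-- Two homomorphisms out of `B_n(G)` agree when they agree on the classes of simplices. -/
theorem eq_of_forall_pi {A : Type*} [AddCommGroup A] (f g : SimplicialBurnsideGroup n G →+ A)
    (h : ∀ X : Simplex n G, f (pi X) = g (pi X)) (x : SimplicialBurnsideGroup n G) : f x = g x :=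
  DFunLike.congr_fun (GrothendieckGroup.hom_ext h) x

theorem faceHom_faceHom {i j : Fin (n + 2)} (hi : i.castSucc ≠ 0) (hi' : i ≠ 0) (hj : j ≠ 0)
    (hj' : j.succ ≠ 0) (h : i ≤ j) (x : SimplicialBurnsideGroup (n + 2) G) :
    (faceHom n j hj).app G ((faceHom (n + 1) i.castSucc hi).app G x) =
      (faceHom n i hi').app G ((faceHom (n + 1) j.succ hj').app G x) :=
  eq_of_forall_pi (((faceHom n j hj).app G).comp ((faceHom (n + 1) i.castSucc hi).app G))
    (((faceHom n i hi').app G).comp ((faceHom (n + 1) j.succ hj').app G)) (fun X => by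
      simp only [AddMonoidHom.comp_apply, faceHom_pi]
      exact congrArg pi (ConcreteCategory.congr_hom
        ((nerve (FinGSet G)).δ_comp_δ h) X).symm) x

theorem degeneracyHom_degeneracyHom {i j : Fin (n + 1)} (h : i ≤ j)
    (x : SimplicialBurnsideGroup n G) :
    (degeneracyHom (n + 1) i.castSucc).app G ((degeneracyHom n j).app G x) =
      (degeneracyHom (n + 1) j.succ).app G ((degeneracyHom n i).app G x) :=
  eq_of_forall_pi (((degeneracyHom (n + 1) i.castSucc).app G).comp ((degeneracyHom n j).app G))
    (((degeneracyHom (n + 1) j.succ).app G).comp ((degeneracyHom n i).app G)) (fun X => by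
      simp only [AddMonoidHom.comp_apply, degeneracyHom_pi]
      exact congrArg pi (ConcreteCategory.congr_hom ((nerve (FinGSet G)).σ_comp_σ h) X)) x

theorem faceHom_degeneracyHom_of_lt {i : Fin (n + 2)} {j : Fin (n + 1)} (hi : i.castSucc ≠ 0)
    (hi' : i ≠ 0) (h : i < j.succ) (x : SimplicialBurnsideGroup (n + 1) G) :
    (faceHom (n + 1) i.castSucc hi).app G ((degeneracyHom (n + 1) j.succ).app G x) =
      (degeneracyHom n j).app G ((faceHom n i hi').app G x) :=
  eq_of_forall_pi
    (((faceHom (n + 1) i.castSucc hi).app G).comp ((degeneracyHom (n + 1) j.succ).app G))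
    (((degeneracyHom n j).app G).comp ((faceHom n i hi').app G)) (fun X => by
      simp only [AddMonoidHom.comp_apply, faceHom_pi, degeneracyHom_pi]
      exact congrArg pi (ConcreteCategory.congr_hom
        ((nerve (FinGSet G)).δ_comp_σ_of_le (Fin.le_castSucc_iff.2 h)) X)) x

theorem faceHom_degeneracyHom_self {i : Fin (n + 2)} {j : Fin (n + 1)} (hi : i ≠ 0)
    (h : i = j.castSucc ∨ i = j.succ) (x : SimplicialBurnsideGroup n G) :
    (faceHom n i hi).app G ((degeneracyHom n j).app G x) = x :=
  eq_of_forall_pi (((faceHom n i hi).app G).comp ((degeneracyHom n j).app G))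
    (AddMonoidHom.id _) (fun X => by
      simp only [AddMonoidHom.comp_apply, faceHom_pi, degeneracyHom_pi]
      rcases h with h | h
      · exact congrArg pi (ConcreteCategory.congr_hom
          ((nerve (FinGSet G)).δ_comp_σ_self' h) X)
      · exact congrArg pi (ConcreteCategory.congr_hom
          ((nerve (FinGSet G)).δ_comp_σ_succ' h) X)) x

theorem faceHom_degeneracyHom_of_gt {i : Fin (n + 2)} {j : Fin (n + 1)} (hi : i.succ ≠ 0)
    (hi' : i ≠ 0) (h : j.castSucc < i) (x : SimplicialBurnsideGroup (n + 1) G) :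
    (faceHom (n + 1) i.succ hi).app G ((degeneracyHom (n + 1) j.castSucc).app G x) =
      (degeneracyHom n j).app G ((faceHom n i hi').app G x) :=
  eq_of_forall_pi
    (((faceHom (n + 1) i.succ hi).app G).comp ((degeneracyHom (n + 1) j.castSucc).app G))
    (((degeneracyHom n j).app G).comp ((faceHom n i hi').app G)) (fun X => by
      simp only [AddMonoidHom.comp_apply, faceHom_pi, degeneracyHom_pi]
      exact congrArg pi (ConcreteCategory.congr_hom
        ((nerve (FinGSet G)).δ_comp_σ_of_gt h) X)) x

end

end SimplicialBurnside

theorem mainTheorem7 :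
    ∃ S : ∀ n : ℕ, GreenBisetFunctor (fun G : BisetCat.{u} => SimplicialBurnsideGroup n G),
      -- the biset functor structure: `Bₙ(U)` sends `π(X)` to `π(U ×_G X)`
      (∀ (n : ℕ) (G H : BisetCat.{u}) (U : Biset H G) (X : Simplex n G),
        (S n).map (BisetCat.homMk U) (pi X) = pi (X.tensor U)) ∧
      -- the product is the external product of simplices
      (∀ (n : ℕ) (G H : BisetCat.{u}) (X : Simplex n G) (Y : Simplex n H),
        (S n).mul (pi X) (pi Y) = pi (X.prod Y)) ∧
      (∀ n : ℕ, (S n).one = pi (Simplex.point n BisetCat.trivial.{u})) ∧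
      -- faces (the one that leaves out `X₀` is excluded) and degeneracies
      ∃ (d : ∀ (n : ℕ) (j : Fin (n + 2)), j ≠ 0 → (S (n + 1)).Hom (S n))
        (s : ∀ (n : ℕ), Fin (n + 1) → (S n).Hom (S (n + 1))),
        (∀ (n : ℕ) (j : Fin (n + 2)) (hj : j ≠ 0) (G : BisetCat.{u}) (X : Simplex (n + 1) G),
          (d n j hj).app G (pi X) = pi (X.face j)) ∧
        (∀ (n : ℕ) (i : Fin (n + 1)) (G : BisetCat.{u}) (X : Simplex n G),
          (s n i).app G (pi X) = pi (X.degeneracy i)) ∧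
        -- `d_j ∘ d_i = d_i ∘ d_{j+1}` for `i ≤ j`
        (∀ (n : ℕ) (i j : Fin (n + 2)) (hi : i.castSucc ≠ 0) (hi' : i ≠ 0) (hj : j ≠ 0)
          (hj' : j.succ ≠ 0), i ≤ j →
          ∀ (G : BisetCat.{u}) (x : SimplicialBurnsideGroup (n + 2) G),
            (d n j hj).app G ((d (n + 1) i.castSucc hi).app G x) =
              (d n i hi').app G ((d (n + 1) j.succ hj').app G x)) ∧
        -- `s_i ∘ s_j = s_{j+1} ∘ s_i` for `i ≤ j`
        (∀ (n : ℕ) (i j : Fin (n + 1)), i ≤ j →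
          ∀ (G : BisetCat.{u}) (x : SimplicialBurnsideGroup n G),
            (s (n + 1) i.castSucc).app G ((s n j).app G x) =
              (s (n + 1) j.succ).app G ((s n i).app G x)) ∧
        -- `d_i ∘ s_{j+1} = s_j ∘ d_i` for `i < j + 1`
        (∀ (n : ℕ) (i : Fin (n + 2)) (j : Fin (n + 1)) (hi : i.castSucc ≠ 0) (hi' : i ≠ 0),
          i < j.succ →
          ∀ (G : BisetCat.{u}) (x : SimplicialBurnsideGroup (n + 1) G),
            (d (n + 1) i.castSucc hi).app G ((s (n + 1) j.succ).app G x) =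
              (s n j).app G ((d n i hi').app G x)) ∧
        -- `d_i ∘ s_j = id` for `i = j` and `i = j + 1`
        (∀ (n : ℕ) (i : Fin (n + 2)) (j : Fin (n + 1)) (hi : i ≠ 0),
          i = j.castSucc ∨ i = j.succ →
          ∀ (G : BisetCat.{u}) (x : SimplicialBurnsideGroup n G),
            (d n i hi).app G ((s n j).app G x) = x) ∧
        -- `d_{i+1} ∘ s_j = s_j ∘ d_i` for `i + 1 > j + 1`
        (∀ (n : ℕ) (i : Fin (n + 2)) (j : Fin (n + 1)) (hi : i.succ ≠ 0) (hi' : i ≠ 0),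
          j.castSucc < i →
          ∀ (G : BisetCat.{u}) (x : SimplicialBurnsideGroup (n + 1) G),
            (d (n + 1) i.succ hi).app G ((s (n + 1) j.castSucc).app G x) =
              (s n j).app G ((d n i hi').app G x)) :=
  ⟨simplicialBurnside, fun _ _ _ U X => Simplex.tensorHom_mk_pi U X, fun _ _ _ X Y => Simplex.prodHom_pi_pi X Y,
    fun _ => rfl, faceHom, degeneracyHom, fun _ j hj _ X => faceHom_pi j hj X,
    fun _ i _ X => degeneracyHom_pi i X,
    fun _ _ _ hi hi' hj hj' h _ x => faceHom_faceHom hi hi' hj hj' h x,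
    fun _ _ _ h _ x => degeneracyHom_degeneracyHom h x,
    fun _ _ _ hi hi' h _ x => faceHom_degeneracyHom_of_lt hi hi' h x,
    fun _ _ _ hi h _ x => faceHom_degeneracyHom_self hi h x,
    fun _ _ _ hi hi' h _ x => faceHom_degeneracyHom_of_gt hi hi' h x⟩
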